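/- Let $k\ge 1$ and $n=2^k$, and let $\log$ denote the logarithm to base $2$, so $\log n=k$. For sets $S_1,\dots,S_k\subset[n]\times[n]$ of cardinality $2n$ let $\hat L_{S_t}\subset Mat_n(\mathbb C)$ be the space of matrices supported on $S_t$, and let $\mathrm{Bfly}_S:\hat L_{S_1}\times\cdots\times\hat L_{S_k}\to Mat_n(\mathbb C)$ be the product map $(M_1,\dots,M_k)\mapsto M_1\cdots M_k$. Let $FM_n^0$ be the union of the images of all these maps (the butterfly matrices) and let $FM_n=\overline{FM_n^0}$ be its Zariski closure. Call $S=(S_1,\dots,S_k)$ efficient if every entry of $M_1\cdots M_k$ is a single monomial in the entries of the factors (for all $i,j$ there is exactly one sequence $i=j_0,j_1,\dots,j_k=j$ with $(j_{t-1},j_t)\in S_t$ for all $t$) and the image of $\mathrm{Bfly}_S$ contains an invertible matrix. A linear circuit is a finite directed acyclic graph with edges labelled by nonzero complex numbers, with $n$ distinct input vertices (without incoming edges) and $n$ distinct output vertices; it computes the matrix whose $(i,j)$ entry is the sum over all paths from input $i$ to output $j$ of the product of the labels along the path; its size is the number of edges. A property holds for a general element of a variety $X$ if it holds outside a Zariski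 closed set whose complement in $X$ is Zariski dense in $X$. Then: (1) The supports of the butterfly graph, $S_t=\{(i,j): j=i \text{ or } j \text{ differs from } i \text{ exactly in binary digit } t-1\}$ (indices $0,\dots,n-1$), are efficient. (2) For every efficient $S$, the closure $\overline{\operatorname{im}\mathrm{Bfly}_S}$ is an irreducible component of $FM_n$ and has dimension $n(\log n+1)$. (3) Every irreducible component of $FM_n$ that contains an invertible matrix has dimension at most $n(\log n+1)$. (4) If $Z$ is an irreducible component of $FM_n$ of dimension at least $n(\log n+1)$, then a general element of $Z$ admits a linear circuit of size $2n\log n$, but admits no linear circuit of size at most $n(\log n+1)-1$. (5) Every $A\in FM_n^0$ admits a linear circuit of size at most $2n\log n$. -/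

import Mathlib

namespace Butterfly

/-! ### Linear circuits -/

/-- A linear circuit with `n` inputs and `m` outputs: a finite directed acyclic graph whose edges
carry nonzero complex labels, with `n` distinct input vertices (which have no incoming edge) and
`m` distinct output vertices. The graph is encoded by the labels: `(u, v)` is an edge
exactly when `label u v ≠ 0`. -/
structure LinearCircuit (n m : ℕ) where
  V : Type
  [fintypeV : Fintype V]
  label : V → V → ℂ
  acyclic : ∀ v, ¬ Relation.TransGen (fun a b => label a b ≠ 0) v v
  input : Fin n ↪ V
  output : Fin m ↪ V
  input_source : ∀ i u, label u (input i) = 0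

namespace LinearCircuit

variable {n m : ℕ}

/-- The size of a linear circuit is its number of edges. -/
noncomputable def size (C : LinearCircuit n m) : ℕ :=
  {e : C.V × C.V | C.label e.1 e.2 ≠ 0}.ncard

open Classical in
/-- The matrix computed by a linear circuit. The `(i, j)` entry is the sum, over all paths from the
`i`-th input to the `j`-th output, of the product of the labels of the edges of the path. A path
with `l` edges is a sequence `p 0, …, p l` of vertices; in an acyclic graph it has fewer edges than
the graph has vertices. Vertex sequences that are not paths contribute `0`. -/
noncomputable def toMatrix (C : LinearCircuit n m) : Matrix (Fin n) (Fin m) ℂ :=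
  letI := C.fintypeV
  fun i j => ∑ l ∈ Finset.range (Fintype.card C.V),
    ∑ p : Fin (l + 1) → C.V with p 0 = C.input i ∧ p (Fin.last l) = C.output j,
      ∏ t : Fin l, C.label (p t.castSucc) (p t.succ)

end LinearCircuit

/-! ### Zariski closed sets of matrices -/

/-- The entries of a matrix, as a point of affine `n²`-space. -/
def entries {n : ℕ} (A : Matrix (Fin n) (Fin n) ℂ) : Fin n × Fin n → ℂ := fun p => A p.1 p.2

/-- The ideal of the polynomials in the matrix entries that vanish on `X`. -/
noncomputable def idealOf {n : ℕ} (X : Set (Matrix (Fin n) (Fin n) ℂ)) :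
    Ideal (MvPolynomial (Fin n × Fin n) ℂ) :=
  MvPolynomial.vanishingIdeal ℂ (entries '' X)

/-- The Zariski closure: the common zero set of all polynomials vanishing on `X`. -/
def zariskiClosure {n : ℕ} (X : Set (Matrix (Fin n) (Fin n) ℂ)) :
    Set (Matrix (Fin n) (Fin n) ℂ) :=
  {A | ∀ f ∈ idealOf X, MvPolynomial.eval (entries A) f = 0}

def IsZariskiClosed {n : ℕ} (X : Set (Matrix (Fin n) (Fin n) ℂ)) : Prop :=
  zariskiClosure X = X

/-- An irreducible variety: a Zariski closed set whose ideal is prime. -/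
def IsIrreducibleVariety {n : ℕ} (X : Set (Matrix (Fin n) (Fin n) ℂ)) : Prop :=
  IsZariskiClosed X ∧ (idealOf X).IsPrime

/-- `Z` is an irreducible component of `X`: a maximal irreducible variety contained in `X`. -/
def IsComponent {n : ℕ} (Z X : Set (Matrix (Fin n) (Fin n) ℂ)) : Prop :=
  Maximal (fun Y => IsIrreducibleVariety Y ∧ Y ⊆ X) Z

/-- The dimension of a variety: the Krull dimension of its coordinate ring. -/
noncomputable def dim {n : ℕ} (X : Set (Matrix (Fin n) (Fin n) ℂ)) : WithBot ℕ∞ :=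
  ringKrullDim (MvPolynomial (Fin n × Fin n) ℂ ⧸ idealOf X)

/-- `P` holds for a general element of the variety `X`: it holds on `X \ W` for some Zariski closed
`W` such that `X \ W` is Zariski dense in `X`. -/
def HoldsForGeneral {n : ℕ} (X : Set (Matrix (Fin n) (Fin n) ℂ))
    (P : Matrix (Fin n) (Fin n) ℂ → Prop) : Prop :=
  ∃ W, IsZariskiClosed W ∧ X ⊆ zariskiClosure (X \ W) ∧ ∀ A ∈ X \ W, P A

/-! ### Butterfly matrices -/

/-- The coordinate subspace of the matrices supported on `S`. -/
def supportedOn {n : ℕ} (S : Finset (Fin n × Fin n)) : Set (Matrix (Fin n) (Fin n) ℂ) :=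
  {M | ∀ i j, (i, j) ∉ S → M i j = 0}

/-- The image of the product map `(S₁, …, S_k) ↦ S₁ ⋯ S_k` on the product of the coordinate
subspaces given by a tuple of supports. -/
def productSet {n k : ℕ} (S : Fin k → Finset (Fin n × Fin n)) :
    Set (Matrix (Fin n) (Fin n) ℂ) :=
  {A | ∃ M : Fin k → Matrix (Fin n) (Fin n) ℂ,
    (∀ t, M t ∈ supportedOn (S t)) ∧ A = (List.ofFn M).prod}

/-- A tuple of `k` supports of cardinality `2n`. -/
def IsConfiguration {n k : ℕ} (S : Fin k → Finset (Fin n × Fin n)) : Prop :=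
  ∀ t, (S t).card = 2 * n

/-- The factorizable (butterfly) matrices of size `2 ^ k`: products of `k` matrices, each of
which is supported on `2n` entries, `n = 2 ^ k`. -/
def butterflyMatrices (k : ℕ) : Set (Matrix (Fin (2 ^ k)) (Fin (2 ^ k)) ℂ) :=
  {A | ∃ S : Fin k → Finset (Fin (2 ^ k) × Fin (2 ^ k)), IsConfiguration S ∧ A ∈ productSet S}

/-- The butterfly variety. -/
def butterflyVariety (k : ℕ) : Set (Matrix (Fin (2 ^ k)) (Fin (2 ^ k)) ℂ) :=
  zariskiClosure (butterflyMatrices k)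

/-- An efficient tuple of supports. The supports have cardinality `2n`; every entry of the product
`S₁ ⋯ S_k` is a single monomial `(S₁)_{i j₁} (S₂)_{j₁ j₂} ⋯ (S_k)_{j_{k-1} j}` in the entries of
the factors, that is, there is exactly one admissible sequence of indices from `i` to `j`; and
the product is not identically singular. -/
def IsEfficient {n k : ℕ} (S : Fin k → Finset (Fin n × Fin n)) : Prop :=
  IsConfiguration S ∧
  (∀ i j : Fin n, ∃! p : Fin (k + 1) → Fin n,
    p 0 = i ∧ p (Fin.last k) = j ∧ ∀ t : Fin k, (p t.castSucc, p t.succ) ∈ S t) ∧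
  ∃ A ∈ productSet S, A.det ≠ 0

/-- The butterfly graph: at level `t`, the index `i` is joined to itself and to the index that
differs from it in the binary digit number `t` only. -/
def butterflyGraph (k : ℕ) : Fin k → Finset (Fin (2 ^ k) × Fin (2 ^ k)) :=
  fun t => {p | p.2 = p.1 ∨ (p.2 : ℕ) = (p.1 : ℕ) ^^^ (2 ^ (t : ℕ))}

end Butterfly

/-! For fixed supports the product map is polynomial, so the closure of its image is irreducible.
`butterflyVariety` is a finite union of such closures, and every component is one of them.

Dimension, upper bound: an invertible product forces every support to contain a perfect matching.
Replacing `M_t` by `D_t M_t D_{t+1}⁻¹`, with invertible diagonal matrices between the factors, keeps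
the product and generically makes the matching entries `1` in all factors but the last. This leaves
`2nk - n(k-1) = n(k+1)` parameters (`idealOf_normalizedSet`, `dim_productSet_le`).

Dimension, equality: for efficient supports the entries of the product are monomials, and each
remaining parameter is an entry or a quotient of two entries, so no dimension is lost
(`productEntries_normalizedFactor_switchPath`, `dim_productSet_eq`). The closure then has the
largest dimension possible for an image closure with an invertible element, hence is a component.

Circuits: by Chevalley's theorem a general element of a component is itself a product, and its
factors are the layers of a circuit. Conversely, the circuits with at most `s` edges give finitely
many polynomial maps in `s` variables, so `s = n(k+1) - 1` edges cannot reach a general element of a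
variety of dimension at least `n(k+1)`. -/

namespace Butterfly

open MvPolynomial Algebra

/-! ### Krull dimension and transcendence degree -/

section KrullDimension

/-- An integral injective extension preserves the Krull dimension. -/
theorem ringKrullDim_eq_of_isIntegral_of_injective {R S : Type*} [CommRing R] [CommRing S]
    (f : R →+* S) (hf : Function.Injective f) (hi : f.IsIntegral) :
    ringKrullDim S = ringKrullDim R := by
  algebraize [f]
  have hinj : Function.Injective (algebraMap R S) := hf
  apply le_antisymm
  -- Incomparability: contraction of primes is strictly monotone.
  · refine Order.krullDim_le_of_strictMono (PrimeSpectrum.comap (algebraMap R S)) ?_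
    intro p q hpq
    exact Ideal.IsIntegral.comap_lt_comap (R := R) (I := p.asIdeal) (J := q.asIdeal) hpq
  -- Lying over for the bottom prime, then going up, lifts a chain without changing its length.
  · refine iSup_le fun l => ?_
    obtain ⟨P, hP, hPl⟩ := Ideal.exists_ideal_over_prime_of_isIntegral l.head.asIdeal (⊥ : Ideal S)
      (by
        intro x hx
        have : x = 0 := hinj (by simpa using hx)
        simp [this])
    have : P.LiesOver l.head.asIdeal := ⟨hPl.2.symm⟩
    have := hPl.1
    obtain ⟨m, hm, -⟩ := Ideal.exists_ltSeries_of_hasGoingUp (S := S) l P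
    rw [← hm]
    exact le_iSup (fun p : LTSeries (PrimeSpectrum S) => (p.length : WithBot ℕ∞)) m

/-- The Krull dimension of an affine domain is its transcendence degree. -/
theorem ringKrullDim_eq_of_trdeg_eq {k R : Type} [Field k] [CommRing R] [IsDomain R] [Algebra k R]
    [Algebra.FiniteType k R] {d : ℕ} (h : Algebra.trdeg k R = d) : ringKrullDim R = d := by
  -- Noether normalization: both invariants equal the number `s` of polynomial variables.
  obtain ⟨s, g, hg, hi⟩ := exists_integral_inj_algHom_of_fg k R
  have h1 : ringKrullDim R = s := by
    rw [ringKrullDim_eq_of_isIntegral_of_injective g.toRingHom hg hi,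
      MvPolynomial.ringKrullDim_of_isNoetherianRing, ringKrullDim_eq_zero_of_field]
    simp
  have h2 : Algebra.trdeg k R = s := by
    let := g.toRingHom.toAlgebra
    have : IsScalarTower k (MvPolynomial (Fin s) k) R :=
      IsScalarTower.of_algebraMap_eq fun x => (g.commutes x).symm
    have : Algebra.IsIntegral (MvPolynomial (Fin s) k) R := ⟨hi⟩
    have : FaithfulSMul (MvPolynomial (Fin s) k) R :=
      (faithfulSMul_iff_algebraMap_injective _ _).2 hg
    have := trdeg_add_eq k (MvPolynomial (Fin s) k) (A := R)
    rw [← this, MvPolynomial.trdeg_of_isDomain, trdeg_eq_zero]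
    simp
  rw [h1]
  rw [h] at h2
  exact_mod_cast h2.symm

theorem ringKrullDim_quotient_ker {k A B : Type*} [CommSemiring k] [CommRing A] [CommRing B]
    [Algebra k A] [Algebra k B] (f : A →ₐ[k] B) :
    ringKrullDim (A ⧸ RingHom.ker f) = ringKrullDim f.range :=
  ringKrullDim_eq_of_ringEquiv (Ideal.quotientKerEquivRange f).toRingEquiv

end KrullDimension

/-! ### Images of polynomial maps -/

section PolynomialMaps

variable {σ ι k : Type} [Field k]

theorem ringKrullDim_quotient_ker_aeval (F : σ → MvPolynomial ι k) :
    ringKrullDim (MvPolynomial σ k ⧸ RingHom.ker (aeval F : MvPolynomial σ k →ₐ[k] MvPolynomial ι k)) =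
      ringKrullDim (aeval F : MvPolynomial σ k →ₐ[k] MvPolynomial ι k).range :=
  ringKrullDim_quotient_ker _

instance finiteType_range_aeval [Finite σ] (F : σ → MvPolynomial ι k) :
    Algebra.FiniteType k (aeval F : MvPolynomial σ k →ₐ[k] MvPolynomial ι k).range :=
  Algebra.FiniteType.of_surjective _ (AlgHom.rangeRestrict_surjective (aeval F))

/-- The coordinate ring of the closure of the image of a polynomial map embeds into the coordinate
ring of the source. -/
theorem ringKrullDim_quotient_ker_aeval_le [Finite σ] [Fintype ι] (F : σ → MvPolynomial ι k) :
    ringKrullDim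
      (MvPolynomial σ k ⧸ RingHom.ker (aeval F : MvPolynomial σ k →ₐ[k] MvPolynomial ι k)) ≤
      (Fintype.card ι : ℕ) := by
  rw [ringKrullDim_quotient_ker_aeval]
  have hle : Algebra.trdeg k (aeval F : MvPolynomial σ k →ₐ[k] MvPolynomial ι k).range ≤
      Fintype.card ι := by
    have := trdeg_le_of_injective (aeval F : MvPolynomial σ k →ₐ[k] MvPolynomial ι k).range.val
      Subtype.val_injective
    rw [MvPolynomial.trdeg_of_isDomain] at this
    simpa using this
  obtain ⟨d, hd⟩ := Cardinal.lt_aleph0.1 (hle.trans_lt Cardinal.natCast_lt_aleph0)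
  rw [ringKrullDim_eq_of_trdeg_eq hd]
  rw [hd] at hle
  exact_mod_cast hle

/-- A subalgebra of a polynomial ring whose field of fractions contains the variables has full
transcendence degree. -/
theorem trdeg_subalgebra_eq_card [Fintype ι] (R : Subalgebra k (MvPolynomial ι k))
    (h : ∀ e, ∃ a ∈ R, ∃ b ∈ R, b ≠ 0 ∧ X e * b = a) :
    Algebra.trdeg k R = Fintype.card ι := by
  have : Algebra.IsAlgebraic R (MvPolynomial ι k) := by
    refine ⟨fun f => ?_⟩
    induction f using MvPolynomial.induction_on with
    | C a => exact isAlgebraic_algebraMap (⟨C a, R.algebraMap_mem a⟩ : R)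
    | add p q hp hq => exact hp.add hq
    | mul_X p e hp =>
      refine hp.mul ?_
      obtain ⟨a, ha, b, hb, hb0, hab⟩ := h e
      -- The variable `X e` is a root of the linear polynomial `b T - a`.
      refine ⟨Polynomial.C ⟨b, hb⟩ * Polynomial.X - Polynomial.C ⟨a, ha⟩, ?_, ?_⟩
      · intro h0
        have := congrArg (fun P : Polynomial R => (P.coeff 1 : MvPolynomial ι k)) h0
        rw [Polynomial.coeff_sub, Polynomial.coeff_C_mul, Polynomial.coeff_X_one,
          Polynomial.coeff_C_succ, Polynomial.coeff_zero] at this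
        exact hb0 (by simpa using this)
      · rw [map_sub, map_mul, Polynomial.aeval_C, Polynomial.aeval_X, Polynomial.aeval_C, sub_eq_zero]
        exact (mul_comm _ _).trans hab
  have h1 := trdeg_add_eq k R (A := MvPolynomial ι k)
  rw [trdeg_eq_zero (R := R), MvPolynomial.trdeg_of_isDomain] at h1
  simpa using h1

/-- If every coordinate of the source is a rational function of the values of a polynomial map,
then the closure of the image has the dimension of the source. -/
theorem ringKrullDim_quotient_ker_aeval_eq [Finite σ] [Fintype ι] (F : σ → MvPolynomial ι k)
    (h : ∀ e, ∃ p q : MvPolynomial σ k, aeval F q ≠ 0 ∧ X e * aeval F q = aeval F p) :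
    ringKrullDim
      (MvPolynomial σ k ⧸ RingHom.ker (aeval F : MvPolynomial σ k →ₐ[k] MvPolynomial ι k)) =
      (Fintype.card ι : ℕ) := by
  rw [ringKrullDim_quotient_ker_aeval]
  refine ringKrullDim_eq_of_trdeg_eq (trdeg_subalgebra_eq_card _ fun e => ?_)
  obtain ⟨p, q, hq, hpq⟩ := h e
  exact ⟨_, ⟨p, rfl⟩, _, ⟨q, rfl⟩, hq, hpq⟩

/-- The image of a polynomial map over an algebraically closed field contains a nonempty open
subset of its closure. -/
theorem exists_notMem_ker_aeval_forall_mem_range [IsAlgClosed k] [Finite σ] [Finite ι]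
    (F : σ → MvPolynomial ι k) :
    ∃ g : MvPolynomial σ k, aeval F g ≠ 0 ∧ ∀ a : σ → k,
      (∀ f : MvPolynomial σ k, aeval F f = 0 → eval a f = 0) → eval a g ≠ 0 →
        ∃ x : ι → k, ∀ s, a s = eval x (F s) := by
  have hfp : (aeval F : MvPolynomial σ k →ₐ[k] MvPolynomial ι k).toRingHom.FinitePresentation := by
    apply RingHom.FinitePresentation.of_finiteType.1
    apply RingHom.FiniteType.of_comp_finiteType (f := algebraMap k (MvPolynomial σ k))
    rw [show (aeval F : MvPolynomial σ k →ₐ[k] MvPolynomial ι k).toRingHom.comp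
      (algebraMap k (MvPolynomial σ k)) = algebraMap k (MvPolynomial ι k) from
        RingHom.ext (aeval F).commutes]
    exact RingHom.finiteType_algebraMap.2 inferInstance
  obtain ⟨T, hT⟩ := PrimeSpectrum.exists_constructibleSetData_iff.2
    (PrimeSpectrum.isConstructible_range_comap hfp)
  -- The generic point of the closure of the image lies in some constructible piece `D`; its
  -- equations then hold on the whole closure, and `D.f` does not vanish identically there.
  have hbot : PrimeSpectrum.comap (aeval F : MvPolynomial σ k →ₐ[k] MvPolynomial ι k).toRingHom
      ⟨⊥, Ideal.isPrime_bot⟩ ∈ T.toSet := by rw [hT]; exact ⟨_, rfl⟩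
  simp only [PrimeSpectrum.ConstructibleSetData.toSet, Set.mem_iUnion] at hbot
  obtain ⟨D, hD, hDg, hDf⟩ := hbot
  refine ⟨D.f, fun h0 => hDf ?_, fun a ha hg => ?_⟩
  · simpa [PrimeSpectrum.mem_zeroLocus] using h0
  · have hmem : (pointToPoint a : PrimeSpectrum (MvPolynomial σ k)) ∈ T.toSet := by
      simp only [PrimeSpectrum.ConstructibleSetData.toSet, Set.mem_iUnion]
      refine ⟨D, hD, ?_, fun hf => hg ?_⟩
      · rw [PrimeSpectrum.mem_zeroLocus]
        intro f hf
        have := hDg hf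
        change f ∈ vanishingIdeal k {a}
        rw [mem_vanishingIdeal_singleton_iff]
        exact ha f (by simpa using this)
      · have := hf (Set.mem_singleton _)
        exact (mem_vanishingIdeal_singleton_iff _ _).1 this
    rw [hT] at hmem
    obtain ⟨q, hq⟩ := hmem
    -- The prime `q` over the point `a` need not be maximal. By the Nullstellensatz a maximal ideal
    -- above it is a point `x`, and the equations `X s - a s` of `a` pull back into it.
    obtain ⟨m, hm, hqm⟩ := Ideal.exists_le_maximal q.asIdeal q.2.ne_top
    obtain ⟨x, rfl⟩ := eq_vanishingIdeal_singleton_of_isMaximal k hm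
    refine ⟨x, fun s => ?_⟩
    have h1 : (X s - C (a s) : MvPolynomial σ k) ∈
        (PrimeSpectrum.comap (aeval F : MvPolynomial σ k →ₐ[k] MvPolynomial ι k).toRingHom
          q).asIdeal := by
      erw [hq]
      change _ ∈ vanishingIdeal k {a}
      rw [mem_vanishingIdeal_singleton_iff]
      simp
    have h2 := hqm h1
    rw [mem_vanishingIdeal_singleton_iff] at h2
    simp [sub_eq_zero] at h2
    exact h2.symm

end PolynomialMaps

end Butterfly

namespace Butterfly

open MvPolynomial

/-! ### Zariski closures, irreducibility and dimension -/

section Varieties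

variable {n : ℕ} {ι : Type}

theorem mem_idealOf {X : Set (Matrix (Fin n) (Fin n) ℂ)} {f : MvPolynomial (Fin n × Fin n) ℂ} :
    f ∈ idealOf X ↔ ∀ A ∈ X, eval (entries A) f = 0 := by
  simp [idealOf, mem_vanishingIdeal_iff, aeval_eq_eval]

theorem idealOf_anti {X Y : Set (Matrix (Fin n) (Fin n) ℂ)} (h : X ⊆ Y) : idealOf Y ≤ idealOf X :=
  fun _ hf => mem_idealOf.2 fun A hA => mem_idealOf.1 hf A (h hA)

theorem subset_zariskiClosure (X : Set (Matrix (Fin n) (Fin n) ℂ)) : X ⊆ zariskiClosure X :=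
  fun A hA _ hf => mem_idealOf.1 hf A hA

theorem idealOf_zariskiClosure (X : Set (Matrix (Fin n) (Fin n) ℂ)) :
    idealOf (zariskiClosure X) = idealOf X :=
  le_antisymm (idealOf_anti (subset_zariskiClosure X))
    fun f hf => mem_idealOf.2 fun _ hA => hA f hf

theorem zariskiClosure_subset_zariskiClosure_iff {X Y : Set (Matrix (Fin n) (Fin n) ℂ)} :
    zariskiClosure X ⊆ zariskiClosure Y ↔ idealOf Y ≤ idealOf X := by
  refine ⟨fun h => ?_, fun h A hA f hf => hA f (h hf)⟩
  rw [← idealOf_zariskiClosure X, ← idealOf_zariskiClosure Y]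
  exact idealOf_anti h

theorem zariskiClosure_mono {X Y : Set (Matrix (Fin n) (Fin n) ℂ)} (h : X ⊆ Y) :
    zariskiClosure X ⊆ zariskiClosure Y :=
  zariskiClosure_subset_zariskiClosure_iff.2 (idealOf_anti h)

theorem isZariskiClosed_zariskiClosure (X : Set (Matrix (Fin n) (Fin n) ℂ)) :
    IsZariskiClosed (zariskiClosure X) := by
  refine (subset_zariskiClosure _).antisymm' fun A hA f hf => hA f ?_
  rwa [idealOf_zariskiClosure]

theorem dim_zariskiClosure (X : Set (Matrix (Fin n) (Fin n) ℂ)) :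
    dim (zariskiClosure X) = dim X := by
  rw [dim, dim, idealOf_zariskiClosure]

/-- Comparing ideals instead of sets allows images that are not closed. -/
theorem dim_mono {X Y : Set (Matrix (Fin n) (Fin n) ℂ)} (h : idealOf Y ≤ idealOf X) :
    dim X ≤ dim Y :=
  ringKrullDim_le_of_surjective (Ideal.Quotient.factor h) (Ideal.Quotient.factor_surjective h)

/-- A proper subvariety of an irreducible variety has smaller dimension. -/
theorem eq_of_subset_of_dim_le {Y Z : Set (Matrix (Fin n) (Fin n) ℂ)} {d : ℕ}
    (hY : IsZariskiClosed Y) (hZ : IsIrreducibleVariety Z) (h : Y ⊆ Z) (hd : dim Y = d)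
    (hdim : dim Z ≤ d) : Y = Z := by
  have hle := idealOf_anti h
  have hge : idealOf Y ≤ idealOf Z := by
    by_contra hne
    obtain ⟨f, hfY, hfZ⟩ := Set.not_subset.1 hne
    have := hZ.2
    -- Killing a nonzero element of a domain lowers the dimension by at least one.
    have h1 := ringKrullDim_succ_le_of_surjective (Ideal.Quotient.factor hle)
      (Ideal.Quotient.factor_surjective hle) (r := Ideal.Quotient.mk _ f)
      (mem_nonZeroDivisors_of_ne_zero fun h0 => hfZ (Ideal.Quotient.eq_zero_iff_mem.1 h0))
      (by simpa using Ideal.Quotient.eq_zero_iff_mem.2 hfY)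
    change dim Y + 1 ≤ dim Z at h1
    have h2 := h1.trans hdim
    rw [hd] at h2
    have : d + 1 ≤ d := by exact_mod_cast h2
    omega
  rw [← hY, ← hZ.1]
  exact (zariskiClosure_mono h).antisymm (zariskiClosure_subset_zariskiClosure_iff.2 hge)

/-- An irreducible variety in the closure of a finite union lies in the closure of one member. -/
theorem exists_subset_zariskiClosure_of_iUnion {τ : Type*} [Finite τ]
    {Y : Set (Matrix (Fin n) (Fin n) ℂ)} (hY : (idealOf Y).IsPrime)
    (X : τ → Set (Matrix (Fin n) (Fin n) ℂ)) (h : Y ⊆ zariskiClosure (⋃ i, X i)) :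
    ∃ i, Y ⊆ zariskiClosure (X i) := by
  have := Fintype.ofFinite τ
  by_contra! hne
  have : ∀ i, ∃ f ∈ idealOf (X i), f ∉ idealOf Y := by
    intro i
    by_contra! hc
    exact hne i fun A hA f hf => mem_idealOf.1 (hc f hf) A hA
  choose f hfX hfY using this
  have hmem : ∏ i, f i ∈ idealOf Y := by
    refine mem_idealOf.2 fun A hA => h hA _ (mem_idealOf.2 fun B hB => ?_)
    obtain ⟨i, hi⟩ := Set.mem_iUnion.1 hB
    rw [map_prod]
    exact Finset.prod_eq_zero (Finset.mem_univ i) (mem_idealOf.1 (hfX i) B hi)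
  obtain ⟨i, -, hi⟩ := hY.prod_mem_iff.1 hmem
  exact hfY i hi

theorem isZariskiClosed_setOf_eval_eq_zero (g : MvPolynomial (Fin n × Fin n) ℂ) :
    IsZariskiClosed {A : Matrix (Fin n) (Fin n) ℂ | eval (entries A) g = 0} :=
  (subset_zariskiClosure _).antisymm' fun _ hA => hA g (mem_idealOf.2 fun _ hB => hB)

/-- On an irreducible variety, a property which holds where some polynomial does not vanish holds
for a general element. -/
theorem holdsForGeneral_of_forall_eval_ne_zero {Z : Set (Matrix (Fin n) (Fin n) ℂ)}
    (hZ : (idealOf Z).IsPrime) {P : Matrix (Fin n) (Fin n) ℂ → Prop}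
    {g : MvPolynomial (Fin n × Fin n) ℂ} (hg : g ∉ idealOf Z)
    (h : ∀ A ∈ Z, eval (entries A) g ≠ 0 → P A) : HoldsForGeneral Z P := by
  refine ⟨_, isZariskiClosed_setOf_eval_eq_zero g, fun A hA f hf => ?_, fun A hA => h A hA.1 hA.2⟩
  have hfg : f * g ∈ idealOf Z := by
    refine mem_idealOf.2 fun B hB => ?_
    rw [map_mul]
    by_cases hB0 : eval (entries B) g = 0
    · rw [hB0, mul_zero]
    · rw [mem_idealOf.1 hf B ⟨hB, hB0⟩, zero_mul]
  exact mem_idealOf.1 ((hZ.mem_or_mem hfg).resolve_right hg) A hA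

/-- The image of the polynomial map with the given coordinates. -/
def polynomialImage (F : Fin n × Fin n → MvPolynomial ι ℂ) : Set (Matrix (Fin n) (Fin n) ℂ) :=
  {A | ∃ x : ι → ℂ, ∀ p, entries A p = eval x (F p)}

theorem eval_entries_of_eq {F : Fin n × Fin n → MvPolynomial ι ℂ}
    {A : Matrix (Fin n) (Fin n) ℂ} {x : ι → ℂ} (h : ∀ p, entries A p = eval x (F p))
    (f : MvPolynomial (Fin n × Fin n) ℂ) : eval (entries A) f = eval x (aeval F f) := by
  rw [funext h, ← aeval_eq_eval, ← aeval_eq_eval, aeval_eq_eval]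
  induction f using MvPolynomial.induction_on with
  | C a => simp
  | add p q hp hq => rw [map_add, map_add, map_add, hp, hq]
  | mul_X p e hp => rw [map_mul, map_mul, map_mul, hp]; simp

theorem idealOf_polynomialImage (F : Fin n × Fin n → MvPolynomial ι ℂ) :
    idealOf (polynomialImage F) = RingHom.ker (aeval F : _ →ₐ[ℂ] MvPolynomial ι ℂ) := by
  ext f
  rw [mem_idealOf, RingHom.mem_ker]
  refine ⟨fun h => MvPolynomial.funext fun x => ?_, fun h A ⟨x, hx⟩ => ?_⟩
  · rw [map_zero, ← eval_entries_of_eq (A := fun i j => eval x (F (i, j))) fun p => rfl]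
    exact h _ ⟨x, fun p => rfl⟩
  · rw [eval_entries_of_eq hx, h, map_zero]

theorem isPrime_idealOf_polynomialImage (F : Fin n × Fin n → MvPolynomial ι ℂ) :
    (idealOf (polynomialImage F)).IsPrime := by
  rw [idealOf_polynomialImage]
  exact RingHom.ker_isPrime _

theorem dim_polynomialImage_le [Fintype ι] (F : Fin n × Fin n → MvPolynomial ι ℂ) :
    dim (polynomialImage F) ≤ (Fintype.card ι : ℕ) := by
  rw [dim, idealOf_polynomialImage]
  exact ringKrullDim_quotient_ker_aeval_le F

theorem dim_polynomialImage_eq [Fintype ι] (F : Fin n × Fin n → MvPolynomial ι ℂ)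
    (h : ∀ e, ∃ p q : MvPolynomial (Fin n × Fin n) ℂ,
      aeval F q ≠ 0 ∧ X e * aeval F q = aeval F p) :
    dim (polynomialImage F) = (Fintype.card ι : ℕ) := by
  rw [dim, idealOf_polynomialImage]
  exact ringKrullDim_quotient_ker_aeval_eq F h

/-- Chevalley's theorem for matrices. It is what turns a general element of a closure into an actual
product, with factors from which a circuit can be built. -/
theorem exists_notMem_idealOf_forall_mem_polynomialImage [Finite ι]
    (F : Fin n × Fin n → MvPolynomial ι ℂ) :
    ∃ g, g ∉ idealOf (polynomialImage F) ∧ ∀ A ∈ zariskiClosure (polynomialImage F),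
      eval (entries A) g ≠ 0 → A ∈ polynomialImage F := by
  obtain ⟨g, hg, h⟩ := exists_notMem_ker_aeval_forall_mem_range F
  refine ⟨g, by rwa [idealOf_polynomialImage, RingHom.mem_ker], fun A hA hAg => ?_⟩
  refine h (entries A) (fun f hf => hA f ?_) hAg
  rwa [idealOf_polynomialImage, RingHom.mem_ker]

end Varieties

end Butterfly

namespace Butterfly

open MvPolynomial

/-! ### Matrix products as sums over paths -/

section Paths

/-- The entries of a product of matrices are sums over paths. -/
theorem prod_ofFn_apply_eq_sum {V R : Type*} [Fintype V] [DecidableEq V] [CommSemiring R] {l : ℕ}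
    (G : Fin l → Matrix V V R) (u v : V) :
    (List.ofFn G).prod u v = ∑ p : Fin (l + 1) → V with p 0 = u ∧ p (Fin.last l) = v,
      ∏ t : Fin l, G t (p t.castSucc) (p t.succ) := by
  induction l generalizing u with
  | zero =>
    rw [List.ofFn_zero, List.prod_nil, Finset.sum_filter,
      ← (Equiv.funUnique (Fin 1) V).symm.sum_comp]
    simp [Matrix.one_apply, ite_and]
  | succ l ih =>
    have hsum : ∑ p : Fin (l + 2) → V with p 0 = u ∧ p (Fin.last (l + 1)) = v,
        ∏ t, G t (p t.castSucc) (p t.succ) =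
        ∑ p : Fin (l + 1) → V, if p (Fin.last l) = v then
          G 0 u (p 0) * ∏ t : Fin l, G t.succ (p t.castSucc) (p t.succ) else 0 := by
      rw [Finset.sum_filter, ← (Fin.consEquiv fun _ : Fin (l + 2) => V).sum_comp,
        Fintype.sum_prod_type, Finset.sum_eq_single u]
      · refine Finset.sum_congr rfl fun p _ => ?_
        simp [Fin.prod_univ_succ, Fin.consEquiv, ← Fin.succ_last]
      · intro w _ hw
        refine Finset.sum_eq_zero fun p _ => ?_
        simp [Fin.consEquiv, hw]
      · simp
    rw [hsum, List.ofFn_succ, List.prod_cons, Matrix.mul_apply]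
    simp only [ih, Finset.sum_filter, Finset.mul_sum]
    rw [Finset.sum_comm]
    refine Finset.sum_congr rfl fun p _ => ?_
    rw [Finset.sum_eq_single (p 0)]
    · simp
    · intro w _ hw
      simp [hw.symm]
    · simp

/-- If a path is the only one between its ends, then the corresponding entry of the product is a
monomial. -/
theorem prod_ofFn_apply_eq_prod {V R : Type*} [Fintype V] [DecidableEq V] [CommSemiring R] {l : ℕ}
    {S : Fin l → Finset (V × V)} {G : Fin l → Matrix V V R}
    (hG : ∀ t i j, (i, j) ∉ S t → G t i j = 0) (p : Fin (l + 1) → V)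
    (hp : ∀ q : Fin (l + 1) → V, q 0 = p 0 → q (Fin.last l) = p (Fin.last l) →
      (∀ t : Fin l, (q t.castSucc, q t.succ) ∈ S t) → q = p) :
    (List.ofFn G).prod (p 0) (p (Fin.last l)) = ∏ t : Fin l, G t (p t.castSucc) (p t.succ) := by
  rw [prod_ofFn_apply_eq_sum, Finset.sum_eq_single p]
  · intro q hq hne
    rw [Finset.mem_filter] at hq
    by_contra h0
    refine hne (hp q hq.2.1 hq.2.2 fun t => ?_)
    by_contra hc
    exact h0 (Finset.prod_eq_zero (Finset.mem_univ t) (hG _ _ _ hc))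
  · simp

/-- Inserting matrices and their inverses between the factors of a product. -/
theorem prod_ofFn_gauge {R : Type*} [Monoid R] (D D' : ℕ → R) (h : ∀ t, D' t * D t = 1) {l : ℕ}
    (M : Fin l → R) :
    (List.ofFn fun t : Fin l => D t * M t * D' (t + 1)).prod * D l = D 0 * (List.ofFn M).prod := by
  induction l with
  | zero => simp
  | succ l ih =>
    have := ih fun t => M t.castSucc
    rw [List.ofFn_succ', List.ofFn_succ', List.concat_eq_append, List.concat_eq_append,
      List.prod_append, List.prod_append, List.prod_singleton, List.prod_singleton,
      ← mul_assoc (D 0), ← this]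
    simp [mul_assoc, h]

theorem map_prod_ofFn_apply {V R R' : Type*} [Fintype V] [DecidableEq V] [CommSemiring R]
    [CommSemiring R'] (f : R →+* R') {l : ℕ} (G : Fin l → Matrix V V R) (u v : V) :
    f ((List.ofFn G).prod u v) = (List.ofFn fun t => (G t).map f).prod u v := by
  have := map_list_prod f.mapMatrix (List.ofFn G)
  rw [List.map_ofFn] at this
  exact congrFun (congrFun this u) v

end Paths

end Butterfly

namespace Butterfly

open MvPolynomial

/-! ### Normalization and the dimension of product sets -/

section ProductSets

variable {n k : ℕ} {ι : Type}

/-- The entries of the product of a tuple of matrices of polynomials. -/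
noncomputable def productEntries (G : Fin k → Matrix (Fin n) (Fin n) (MvPolynomial ι ℂ)) :
    Fin n × Fin n → MvPolynomial ι ℂ :=
  fun p => (List.ofFn G).prod p.1 p.2

theorem mem_polynomialImage_productEntries
    {G : Fin k → Matrix (Fin n) (Fin n) (MvPolynomial ι ℂ)} {A : Matrix (Fin n) (Fin n) ℂ} :
    A ∈ polynomialImage (productEntries G) ↔
      ∃ x : ι → ℂ, A = (List.ofFn fun t => (G t).map (eval x)).prod := by
  refine exists_congr fun x => ⟨fun h => ?_, fun h p => ?_⟩
  · ext i j
    rw [← map_prod_ofFn_apply]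
    exact h (i, j)
  · rw [h, entries, ← map_prod_ofFn_apply]
    rfl

/-- The generic matrices with the given supports. -/
noncomputable def genericFactor (S : Fin k → Finset (Fin n × Fin n)) (t : Fin k) :
    Matrix (Fin n) (Fin n) (MvPolynomial (Fin k × Fin n × Fin n) ℂ) :=
  .of fun i j => if (i, j) ∈ S t then X (t, i, j) else 0

theorem productSet_eq_polynomialImage (S : Fin k → Finset (Fin n × Fin n)) :
    productSet S = polynomialImage (productEntries (genericFactor S)) := by
  ext A
  rw [mem_polynomialImage_productEntries]
  constructor
  · rintro ⟨M, hM, rfl⟩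
    refine ⟨fun e => M e.1 e.2.1 e.2.2, ?_⟩
    congr 2
    funext t
    ext i j
    by_cases h : (i, j) ∈ S t
    · simp [genericFactor, h]
    · simp [genericFactor, h, hM t i j h]
  · rintro ⟨x, rfl⟩
    refine ⟨_, fun t i j h => ?_, rfl⟩
    simp [genericFactor, h]

/-- The determinant is a polynomial in the entries, so if it vanishes on `X` it vanishes on the
closure. -/
theorem exists_det_ne_zero_of_zariskiClosure {X : Set (Matrix (Fin n) (Fin n) ℂ)}
    (h : ∃ A ∈ zariskiClosure X, A.det ≠ 0) : ∃ A ∈ X, A.det ≠ 0 := by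
  by_contra! h0
  obtain ⟨A, hA, hdet⟩ := h
  have heval : ∀ B : Matrix (Fin n) (Fin n) ℂ, eval (entries B)
      (Matrix.det (.of fun i j => MvPolynomial.X (i, j)) : MvPolynomial (Fin n × Fin n) ℂ) = B.det := by
    intro B
    rw [RingHom.map_det]
    congr 1
    ext i j
    simp [entries]
  refine hdet ?_
  rw [← heval]
  exact hA _ (mem_idealOf.2 fun B hB => by rw [heval, h0 B hB])

/-- The supports of a tuple with an invertible product contain perfect matchings. -/
theorem exists_matching_of_det_ne_zero {S : Fin k → Finset (Fin n × Fin n)}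
    (h : ∃ A ∈ productSet S, A.det ≠ 0) :
    ∃ σ : Fin k → Equiv.Perm (Fin n), ∀ t i, (i, σ t i) ∈ S t := by
  obtain ⟨A, ⟨M, hM, rfl⟩, hdet⟩ := h
  have : ∀ t, ∃ σ : Equiv.Perm (Fin n), ∀ i, (i, σ i) ∈ S t := by
    intro t
    have hMt : (M t).det ≠ 0 := by
      intro h0
      refine hdet ?_
      rw [← Matrix.coe_detMonoidHom, map_list_prod]
      refine List.prod_eq_zero ?_
      rw [List.map_ofFn, List.mem_ofFn]
      exact ⟨t, h0⟩
    -- A nonzero term of the Leibniz expansion is a perfect matching; the transpose puts its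
    -- positions in the form `(i, σ i)`.
    rw [← Matrix.det_transpose, Matrix.det_apply] at hMt
    obtain ⟨σ, -, hσ⟩ := Finset.exists_ne_zero_of_sum_ne_zero hMt
    refine ⟨σ, fun i => ?_⟩
    by_contra hc
    refine hσ ?_
    rw [Finset.prod_eq_zero (Finset.mem_univ i), smul_zero]
    exact hM t i (σ i) hc
  choose σ hσ using this
  exact ⟨σ, hσ⟩

/-- The pairs of the supports which are free after normalizing the entries on the matchings `σ` of
all factors but the last. -/
abbrev FreeEdge (S : Fin k → Finset (Fin n × Fin n)) (σ : Fin k → Equiv.Perm (Fin n)) : Type :=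
  {e : Fin k × Fin n × Fin n // e.2 ∈ S e.1 ∧ ¬ ((e.1 : ℕ) + 1 < k ∧ e.2.2 = σ e.1 e.2.1)}

/-- Each of the first `k - 1` factors keeps `2n - n` free entries and the last keeps all `2n`. -/
theorem card_freeEdge {S : Fin k → Finset (Fin n × Fin n)} {σ : Fin k → Equiv.Perm (Fin n)}
    (hk : 1 ≤ k) (hS : IsConfiguration S) (hσ : ∀ t i, (i, σ t i) ∈ S t) :
    Fintype.card (FreeEdge S σ) = n * (k + 1) := by
  have h1 : Fintype.card (FreeEdge S σ) =
      ∑ t : Fin k, Fintype.card {p : Fin n × Fin n //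
        p ∈ S t ∧ ¬ ((t : ℕ) + 1 < k ∧ p.2 = σ t p.1)} := by
    rw [← Fintype.card_sigma]
    exact Fintype.card_congr
      ⟨fun e => ⟨e.1.1, e.1.2, e.2⟩, fun e => ⟨(e.1, e.2.1), e.2.2⟩, fun _ => rfl, fun _ => rfl⟩
  obtain ⟨k, rfl⟩ := Nat.exists_eq_add_of_le' hk
  have h2 : ∀ t : Fin k, Fintype.card {p : Fin n × Fin n // p ∈ S t.castSucc ∧
      ¬ ((t.castSucc : ℕ) + 1 < k + 1 ∧ p.2 = σ t.castSucc p.1)} = n := by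
    intro t
    let f : Fin n ↪ Fin n × Fin n :=
      ⟨fun i => (i, σ t.castSucc i), fun i j h => (Prod.ext_iff.1 h).1⟩
    have hf : ∀ i, f i = (i, σ t.castSucc i) := fun _ => rfl
    have hsub : Finset.univ.map f ⊆
        S t.castSucc := by
      intro p hp
      obtain ⟨i, -, rfl⟩ := Finset.mem_map.1 hp
      exact hσ _ i
    have hcard := Finset.card_sdiff_add_card_eq_card hsub
    rw [hS, Finset.card_map, Finset.card_fin] at hcard
    rw [Fintype.card_subtype]
    have : ({p | p ∈ S t.castSucc ∧ ¬ ((t.castSucc : ℕ) + 1 < k + 1 ∧ p.2 = σ t.castSucc p.1)} :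
        Finset (Fin n × Fin n)) = S t.castSucc \
          Finset.univ.map f := by
      ext ⟨i, j⟩
      have := t.2
      simp [hf, eq_comm]
    rw [this]
    omega
  have h3 : Fintype.card {p : Fin n × Fin n // p ∈ S (Fin.last k) ∧
      ¬ (((Fin.last k : Fin (k + 1)) : ℕ) + 1 < k + 1 ∧ p.2 = σ (Fin.last k) p.1)} = 2 * n := by
    rw [← hS (Fin.last k), ← Fintype.card_coe]
    exact Fintype.card_congr (Equiv.subtypeEquivRight fun p => by simp)
  rw [h1, Fin.sum_univ_castSucc, h3]
  simp only [h2]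
  simp
  ring

/-- The generic matrices with the given supports whose entries on the matchings are `1` in all
factors but the last. -/
noncomputable def normalizedFactor (S : Fin k → Finset (Fin n × Fin n))
    (σ : Fin k → Equiv.Perm (Fin n)) (t : Fin k) :
    Matrix (Fin n) (Fin n) (MvPolynomial (FreeEdge S σ) ℂ) :=
  .of fun i j => if h : (i, j) ∈ S t ∧ ¬ ((t : ℕ) + 1 < k ∧ j = σ t i) then X ⟨(t, i, j), h⟩
    else if (i, j) ∈ S t then 1 else 0

theorem normalizedFactor_of_notMem {S : Fin k → Finset (Fin n × Fin n)}
    {σ : Fin k → Equiv.Perm (Fin n)} {t : Fin k} {i j : Fin n} (h : (i, j) ∉ S t) :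
    normalizedFactor S σ t i j = 0 := by
  simp [normalizedFactor, h]

theorem normalizedFactor_matching {S : Fin k → Finset (Fin n × Fin n)}
    {σ : Fin k → Equiv.Perm (Fin n)} (hσ : ∀ t i, (i, σ t i) ∈ S t) {t : Fin k}
    (ht : (t : ℕ) + 1 < k) (i : Fin n) : normalizedFactor S σ t i (σ t i) = 1 := by
  simp [normalizedFactor, hσ, ht]

theorem normalizedFactor_ne_zero {S : Fin k → Finset (Fin n × Fin n)}
    {σ : Fin k → Equiv.Perm (Fin n)} {t : Fin k} {i j : Fin n} (h : (i, j) ∈ S t) :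
    normalizedFactor S σ t i j ≠ 0 := by
  simp only [normalizedFactor, Matrix.of_apply, h, if_true]
  split_ifs
  · exact X_ne_zero _
  · exact one_ne_zero

/-- The products of normalized matrices with the given supports. -/
noncomputable def normalizedSet (S : Fin k → Finset (Fin n × Fin n))
    (σ : Fin k → Equiv.Perm (Fin n)) : Set (Matrix (Fin n) (Fin n) ℂ) :=
  polynomialImage (productEntries (normalizedFactor S σ))

theorem normalizedSet_subset_productSet (S : Fin k → Finset (Fin n × Fin n))
    (σ : Fin k → Equiv.Perm (Fin n)) : normalizedSet S σ ⊆ productSet S := by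
  intro A hA
  obtain ⟨x, rfl⟩ := mem_polynomialImage_productEntries.1 hA
  refine ⟨_, fun t i j h => ?_, rfl⟩
  simp [normalizedFactor_of_notMem h]

/-- The scalings which normalize a tuple of matrices. -/
noncomputable def gauge (σ : Fin k → Equiv.Perm (Fin n)) (M : Fin k → Matrix (Fin n) (Fin n) ℂ) :
    ℕ → Fin n → ℂ
  | 0 => 1
  -- The recursion makes the rescaled matching entries `1`. From level `k` on the scaling is
  -- trivial, as at level `0`, so that the product does not change; hence the last factor stays
  -- unnormalized.
  | t + 1 => fun j => if h : t + 1 < k then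
      gauge σ M t ((σ ⟨t, by omega⟩).symm j) *
        M ⟨t, by omega⟩ ((σ ⟨t, by omega⟩).symm j) j else 1

theorem gauge_ne_zero {σ : Fin k → Equiv.Perm (Fin n)} {M : Fin k → Matrix (Fin n) (Fin n) ℂ}
    (h : ∀ t i, M t i (σ t i) ≠ 0) (t : ℕ) (j : Fin n) : gauge σ M t j ≠ 0 := by
  induction t generalizing j with
  | zero => simp [gauge]
  | succ t ih =>
    rw [gauge]
    split_ifs with ht
    · refine mul_ne_zero (ih _) ?_
      have := h ⟨t, by omega⟩ ((σ ⟨t, by omega⟩).symm j)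
      rwa [Equiv.apply_symm_apply] at this
    · exact one_ne_zero

theorem prod_mem_normalizedSet (hk : 1 ≤ k) {S : Fin k → Finset (Fin n × Fin n)}
    {σ : Fin k → Equiv.Perm (Fin n)}
    {M : Fin k → Matrix (Fin n) (Fin n) ℂ} (hM : ∀ t, M t ∈ supportedOn (S t))
    (h : ∀ t i, M t i (σ t i) ≠ 0) : (List.ofFn M).prod ∈ normalizedSet S σ := by
  have hg := gauge_ne_zero h
  have hprod := prod_ofFn_gauge (fun t => Matrix.diagonal (gauge σ M t))
    (fun t => Matrix.diagonal fun j => (gauge σ M t j)⁻¹)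
    (fun t => by simp [Matrix.diagonal_mul_diagonal, hg]) M
  have h0 : Matrix.diagonal (gauge σ M 0) = 1 := by simp [gauge]
  have hl : Matrix.diagonal (gauge σ M k) = 1 := by
    obtain ⟨k, rfl⟩ := Nat.exists_eq_add_of_le' hk
    rw [← Matrix.diagonal_one]
    congr 1
    funext j
    simp [gauge]
  rw [h0, hl, mul_one, one_mul] at hprod
  rw [← hprod]
  refine mem_polynomialImage_productEntries.2
    ⟨fun e => gauge σ M e.1.1 e.1.2.1 * M e.1.1 e.1.2.1 e.1.2.2 *
      (gauge σ M (e.1.1 + 1) e.1.2.2)⁻¹, ?_⟩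
  congr 2
  funext t
  ext i j
  rw [Matrix.mul_diagonal, Matrix.diagonal_mul, Matrix.map_apply]
  by_cases hS : (i, j) ∈ S t
  · by_cases hj : (t : ℕ) + 1 < k ∧ j = σ t i
    · obtain ⟨ht, rfl⟩ := hj
      have h1 : gauge σ M (t + 1) (σ t i) = gauge σ M t i * M t i (σ t i) := by
        simp [gauge, ht]
      rw [h1, mul_inv_cancel₀ (mul_ne_zero (hg _ _) (h _ _))]
      simp [normalizedFactor, hS, ht]
    · have hc : (i, j) ∈ S t ∧ ¬ ((t : ℕ) + 1 < k ∧ j = σ t i) := ⟨hS, hj⟩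
      simp only [normalizedFactor, Matrix.of_apply, dif_pos hc, eval_X]
  · rw [normalizedFactor_of_notMem hS, hM t i j hS]
    simp

/-- Normalization works wherever no matching entry vanishes. This is a nonempty open condition on
the parameters, so the normalized products are dense. -/
theorem idealOf_normalizedSet (hk : 1 ≤ k) {S : Fin k → Finset (Fin n × Fin n)}
    {σ : Fin k → Equiv.Perm (Fin n)} (hσ : ∀ t i, (i, σ t i) ∈ S t) :
    idealOf (normalizedSet S σ) = idealOf (productSet S) := by
  refine le_antisymm (fun f hf => ?_) (idealOf_anti (normalizedSet_subset_productSet S σ))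
  rw [productSet_eq_polynomialImage, idealOf_polynomialImage, RingHom.mem_ker]
  have hX : (∏ e : Fin k × Fin n, X (e.1, e.2, σ e.1 e.2) :
      MvPolynomial (Fin k × Fin n × Fin n) ℂ) ≠ 0 :=
    Finset.prod_ne_zero_iff.2 fun e _ => X_ne_zero _
  -- The pullback of `f` times the product of all matching variables vanishes at every point: one
  -- factor or the other is zero.
  refine (mul_eq_zero.1 (MvPolynomial.funext fun x => ?_)).resolve_right hX
  rw [map_mul, map_zero, map_prod]
  by_cases h : ∀ e : Fin k × Fin n, x (e.1, e.2, σ e.1 e.2) ≠ 0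
  · have hA : (List.ofFn fun t => (genericFactor S t).map (eval x)).prod ∈ normalizedSet S σ := by
      refine prod_mem_normalizedSet hk (fun t i j hij => ?_) fun t i => ?_
      · simp [genericFactor, hij]
      · simpa [genericFactor, hσ] using h (t, i)
    rw [← eval_entries_of_eq
      (A := (List.ofFn fun t => (genericFactor S t).map (eval x)).prod), mem_idealOf.1 hf _ hA,
      zero_mul]
    intro p
    rw [productEntries, map_prod_ofFn_apply]
    rfl
  · push Not at h
    obtain ⟨e, he⟩ := h
    rw [Finset.prod_eq_zero (Finset.mem_univ e) (by simpa using he), mul_zero]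

theorem dim_productSet_le (hk : 1 ≤ k) {S : Fin k → Finset (Fin n × Fin n)}
    (hS : IsConfiguration S) (h : ∃ A ∈ productSet S, A.det ≠ 0) :
    dim (productSet S) ≤ ((n * (k + 1) : ℕ) : WithBot ℕ∞) := by
  obtain ⟨σ, hσ⟩ := exists_matching_of_det_ne_zero h
  rw [dim, ← idealOf_normalizedSet hk hσ, ← card_freeEdge hk hS hσ]
  exact dim_polynomialImage_le _

/-- The composition of the first `t` matchings. -/
def matchingLine (σ : Fin k → Equiv.Perm (Fin n)) : ℕ → Equiv.Perm (Fin n)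
  | 0 => 1
  | t + 1 => if h : t < k then σ ⟨t, h⟩ * matchingLine σ t else 1

theorem matchingLine_succ (σ : Fin k → Equiv.Perm (Fin n)) (t : Fin k) (a : Fin n) :
    matchingLine σ (t + 1) a = σ t (matchingLine σ t a) := by
  rw [matchingLine, dif_pos t.2]
  rfl

/-- The path which follows the matchings from `a` up to the level `t`, and then those from `b`. -/
def switchPath (σ : Fin k → Equiv.Perm (Fin n)) (t : ℕ) (a b : Fin n) (s : Fin (k + 1)) : Fin n :=
  if (s : ℕ) ≤ t then matchingLine σ s a else matchingLine σ s b

/-- Efficiency makes the entry a monomial along the switch path. Before level `t` only normalized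
matching entries occur, so `a` enters only through the switching edge and the remaining product
depends on `b` alone. -/
theorem productEntries_normalizedFactor_switchPath {S : Fin k → Finset (Fin n × Fin n)}
    (hS : IsEfficient S) {σ : Fin k → Equiv.Perm (Fin n)} (hσ : ∀ t i, (i, σ t i) ∈ S t)
    (t : Fin k) (a b : Fin n)
    (hab : (matchingLine σ t a, matchingLine σ (t + 1) b) ∈ S t) :
    productEntries (normalizedFactor S σ)
        (switchPath σ t a b 0, switchPath σ t a b (Fin.last k)) =
      normalizedFactor S σ t (matchingLine σ t a) (matchingLine σ (t + 1) b) *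
        ∏ s : Fin k with t < s,
          normalizedFactor S σ s (matchingLine σ s b) (matchingLine σ (s + 1) b) := by
  have hpath : ∀ s : Fin k, (switchPath σ t a b s.castSucc, switchPath σ t a b s.succ) =
      if s = t then (matchingLine σ t a, matchingLine σ (t + 1) b) else
        if t < s then (matchingLine σ s b, σ s (matchingLine σ s b))
        else (matchingLine σ s a, σ s (matchingLine σ s a)) := by
    intro s
    simp only [switchPath, Fin.val_castSucc, Fin.val_succ, matchingLine_succ]
    rcases lt_trichotomy s t with hst | rfl | hst
    · have h1 : (s : ℕ) < t := hst
      simp [hst.ne, hst.not_gt, h1.le, h1]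
    · simp
    · have h1 : (t : ℕ) < s := hst
      have h2 : ¬ (s : ℕ) + 1 ≤ t := by omega
      simp [hst.ne', hst, h2]
  have hmem : ∀ s : Fin k, (switchPath σ t a b s.castSucc, switchPath σ t a b s.succ) ∈ S s := by
    intro s
    rw [hpath]
    split_ifs with h1 h2
    · rw [h1]; exact hab
    · exact hσ _ _
    · exact hσ _ _
  rw [productEntries, prod_ofFn_apply_eq_prod (S := S)
    (fun t i j h => normalizedFactor_of_notMem h) (switchPath σ t a b)
    fun q hq0 hql hq => (hS.2.1 _ _).unique ⟨hq0, hql, hq⟩ ⟨rfl, rfl, hmem⟩]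
  have hval : ∀ s : Fin k, normalizedFactor S σ s (switchPath σ t a b s.castSucc)
      (switchPath σ t a b s.succ) = (if s = t then normalizedFactor S σ t (matchingLine σ t a)
        (matchingLine σ (t + 1) b) else 1) * if t < s then
          normalizedFactor S σ s (matchingLine σ s b) (matchingLine σ (s + 1) b) else 1 := by
    intro s
    have h := hpath s
    have hfst := congrArg Prod.fst h
    have hsnd := congrArg Prod.snd h
    dsimp only at hfst hsnd
    rw [hfst, hsnd]
    rcases lt_trichotomy s t with hst | rfl | hst
    · have h1 : (s : ℕ) < t := hst
      have := t.2
      simp only [hst.ne, hst.not_gt, if_false]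
      -- Since `s < t < k`, the factor `s` is not the last one.
      rw [normalizedFactor_matching hσ (by omega), one_mul]
    · simp
    · simp [hst.ne', hst, matchingLine_succ]
  simp only [hval]
  rw [Finset.prod_mul_distrib, Finset.prod_filter]
  simp

/-- A free variable is isolated by dividing the entry whose path switches along its edge by the
entry of the path that stays on the line of `b`. -/
theorem dim_productSet_eq (hk : 1 ≤ k) {S : Fin k → Finset (Fin n × Fin n)}
    (hS : IsEfficient S) : dim (productSet S) = ((n * (k + 1) : ℕ) : WithBot ℕ∞) := by
  obtain ⟨σ, hσ⟩ := exists_matching_of_det_ne_zero hS.2.2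
  rw [dim, ← idealOf_normalizedSet hk hσ, ← card_freeEdge hk hS.1 hσ]
  refine dim_polynomialImage_eq _ ?_
  rintro ⟨⟨t, u, v⟩, he⟩
  -- The line of `a` passes through `u` at level `t`, that of `b` through `v` at level `t + 1`.
  set a := (matchingLine σ t).symm u
  set b := (matchingLine σ (t + 1)).symm v
  have ha : matchingLine σ t a = u := Equiv.apply_symm_apply _ _
  have hb : matchingLine σ (t + 1) b = v := Equiv.apply_symm_apply _ _
  have h1 := productEntries_normalizedFactor_switchPath hS hσ t a b (by rw [ha, hb]; exact he.1)
  have hX : normalizedFactor S σ t (matchingLine σ t a) (matchingLine σ (t + 1) b) =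
      X ⟨(t, u, v), he⟩ := by
    rw [ha, hb]
    exact dif_pos he
  rw [hX] at h1
  by_cases ht : (t : ℕ) + 1 < k
  · have hbb : (matchingLine σ t b, matchingLine σ (t + 1) b) ∈ S t := by
      rw [matchingLine_succ]
      exact hσ _ _
    have h2 := productEntries_normalizedFactor_switchPath hS hσ t b b hbb
    rw [matchingLine_succ, normalizedFactor_matching hσ ht, one_mul] at h2
    refine ⟨X (switchPath σ t a b 0, switchPath σ t a b (Fin.last k)),
      X (switchPath σ t b b 0, switchPath σ t b b (Fin.last k)), ?_, ?_⟩
    · rw [aeval_X, h2, Finset.prod_ne_zero_iff]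
      intro s _
      rw [matchingLine_succ]
      exact normalizedFactor_ne_zero (hσ _ _)
    · rw [aeval_X, aeval_X, h1, h2]
  -- In the last factor nothing follows the switch, so the entry itself is the variable and the
  -- denominator is `1`.
  · refine ⟨X (switchPath σ t a b 0, switchPath σ t a b (Fin.last k)), 1, by simp, ?_⟩
    rw [aeval_X, h1, map_one]
    congr 1
    refine (Finset.prod_eq_one fun s hs => ?_).symm
    have h3 : (t : ℕ) < s := (Finset.mem_filter.1 hs).2
    have := s.2
    omega

end ProductSets

end Butterfly

namespace Butterfly

/-! ### Efficiency of the butterfly graph -/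

section ButterflyGraph

variable {k : ℕ}

theorem mem_butterflyGraph {t : Fin k} {i j : Fin (2 ^ k)} :
    (i, j) ∈ butterflyGraph k t ↔ j = i ∨ (j : ℕ) = (i : ℕ) ^^^ 2 ^ (t : ℕ) := by
  simp [butterflyGraph]

theorem testBit_eq_of_mem_butterflyGraph {t : Fin k} {i j : Fin (2 ^ k)}
    (h : (i, j) ∈ butterflyGraph k t) {s : ℕ} (hs : s ≠ t) :
    (j : ℕ).testBit s = (i : ℕ).testBit s := by
  obtain rfl | h := mem_butterflyGraph.1 h
  · rfl
  · rw [h, Nat.testBit_xor, Nat.testBit_two_pow_of_ne hs.symm, Bool.xor_false]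

theorem isConfiguration_butterflyGraph (k : ℕ) : IsConfiguration (butterflyGraph k) := by
  intro t
  have ht : 2 ^ (t : ℕ) < 2 ^ k := Nat.pow_lt_pow_right one_lt_two t.2
  have : butterflyGraph k t = Finset.univ.biUnion fun i : Fin (2 ^ k) =>
      {(i, i), (i, ⟨(i : ℕ) ^^^ 2 ^ (t : ℕ), Nat.xor_lt_two_pow i.2 ht⟩)} := by
    ext ⟨i, j⟩
    rw [mem_butterflyGraph]
    simp only [Finset.mem_biUnion, Finset.mem_univ, true_and, Finset.mem_insert,
      Finset.mem_singleton, Prod.mk.injEq, Fin.ext_iff]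
    constructor
    · exact fun h => ⟨i, by simpa using h⟩
    · rintro ⟨a, ⟨h1, h2⟩ | ⟨h1, h2⟩⟩
      · exact Or.inl (h2.trans h1.symm)
      · exact Or.inr (by rw [h2, h1])
  rw [this, Finset.card_biUnion]
  · have hne : ∀ i : Fin (2 ^ k), (i, i) ≠
        (i, (⟨(i : ℕ) ^^^ 2 ^ (t : ℕ), Nat.xor_lt_two_pow i.2 ht⟩ : Fin (2 ^ k))) := by
      intro i h
      have h1 : (i : ℕ) = (i : ℕ) ^^^ 2 ^ (t : ℕ) := congrArg Fin.val (Prod.ext_iff.1 h).2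
      have h2 := congrArg (fun m => m.testBit t) h1
      simp [Nat.testBit_xor, Nat.testBit_two_pow_self] at h2
    rw [Finset.sum_congr rfl fun i _ => Finset.card_pair (hne i)]
    simp [mul_comm]
  · intro i _ j _ hij
    rw [Function.onFun, Finset.disjoint_left]
    rintro ⟨a, b⟩ ha hb
    simp only [Finset.mem_insert, Finset.mem_singleton, Prod.ext_iff] at ha hb
    have h1 : a = i := by tauto
    have h2 : a = j := by tauto
    exact hij (h1.symm.trans h2)

/-- Step `t` may change the binary digit `t` only, so it must replace this digit of `i` by that of
`j`. -/
theorem existsUnique_path_butterflyGraph (i j : Fin (2 ^ k)) :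
    ∃! p : Fin (k + 1) → Fin (2 ^ k), p 0 = i ∧ p (Fin.last k) = j ∧
      ∀ t : Fin k, (p t.castSucc, p t.succ) ∈ butterflyGraph k t := by
  have hd : (i : ℕ) ^^^ j < 2 ^ k := Nat.xor_lt_two_pow i.2 j.2
  -- At level `t` the digits below `t` come from `j` and the others from `i`.
  refine ⟨fun t => ⟨(i : ℕ) ^^^ (((i : ℕ) ^^^ j) % 2 ^ (t : ℕ)),
    Nat.xor_lt_two_pow i.2 ((Nat.mod_le _ _).trans_lt hd)⟩, ⟨?_, ?_, fun t => ?_⟩, ?_⟩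
  · simp [Nat.mod_one]
  · simp [Nat.mod_eq_of_lt hd]
  · rw [mem_butterflyGraph, Fin.ext_iff]
    simp only [Fin.val_succ, Fin.val_castSucc]
    cases hb : ((i : ℕ) ^^^ j).testBit t with
    | false =>
      left
      congr 1
      refine Nat.eq_of_testBit_eq fun s => ?_
      simp only [Nat.testBit_mod_two_pow]
      rcases lt_trichotomy s t with h | rfl | h
      · simp [h, h.trans (Nat.lt_succ_self _)]
      · simp [hb]
      · simp [show ¬ s < (t : ℕ) + 1 by omega, show ¬ s < (t : ℕ) by omega]
    | true =>
      right
      rw [Nat.xor_assoc]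
      congr 1
      refine Nat.eq_of_testBit_eq fun s => ?_
      simp only [Nat.testBit_mod_two_pow, Nat.testBit_xor (_ % _), Nat.testBit_two_pow]
      rcases lt_trichotomy s t with h | rfl | h
      · simp [h, h.ne', h.trans (Nat.lt_succ_self _)]
      · simp [hb]
      · simp [show ¬ s < (t : ℕ) + 1 by omega, show ¬ s < (t : ℕ) by omega, h.ne]
  -- Digits below `t` are fixed from level `t` to the end, where they are those of `j`; the others
  -- are still those of the start.
  · have key : ∀ q : Fin (k + 1) → Fin (2 ^ k), q 0 = i ∧ q (Fin.last k) = j ∧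
        (∀ t : Fin k, (q t.castSucc, q t.succ) ∈ butterflyGraph k t) → ∀ (t : Fin (k + 1)) (s : ℕ),
        (q t : ℕ).testBit s = if s < t then (j : ℕ).testBit s else (i : ℕ).testBit s := by
      rintro q ⟨h0, hl, hq⟩ t s
      split_ifs with hs
      · induction t using Fin.reverseInduction with
        | last => rw [hl]
        | cast t ih =>
          have hst : s < (t : ℕ) := hs
          rw [← ih (by simp; omega), testBit_eq_of_mem_butterflyGraph (hq t) hst.ne]
      · induction t using Fin.induction with
        | zero => rw [h0]
        | succ t ih =>
          have hst : ¬ s < (t : ℕ) + 1 := by simpa using hs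
          rw [testBit_eq_of_mem_butterflyGraph (hq t) (by omega)]
          exact ih (by simp; omega)
    intro q hq
    funext t
    refine Fin.ext (Nat.eq_of_testBit_eq fun s => ?_)
    rw [key q hq]
    simp only [Nat.testBit_xor, Nat.testBit_mod_two_pow]
    split_ifs with hs <;> simp [hs]

/-- The supports of the butterfly graph are efficient. -/
theorem isEfficient_butterflyGraph (k : ℕ) : IsEfficient (butterflyGraph k) := by
  refine ⟨isConfiguration_butterflyGraph k, existsUnique_path_butterflyGraph, 1,
    ⟨fun _ => 1, fun t i j h => Matrix.one_apply_ne fun hij => h ?_, by simp⟩, by simp⟩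
  exact mem_butterflyGraph.2 (Or.inl hij.symm)

end ButterflyGraph

end Butterfly

namespace Butterfly

open MvPolynomial

/-! ### Acyclic graphs and nilpotent matrices -/

section Acyclic

variable {V R : Type*} [Fintype V] [DecidableEq V] [CommSemiring R]

/-- The powers of the adjacency matrix of an acyclic graph eventually vanish. -/
theorem pow_eq_zero_of_acyclic [Nontrivial R] {L : Matrix V V R}
    (h : ∀ v, ¬ Relation.TransGen (fun a b => L a b ≠ 0) v v) {l : ℕ} (hl : Fintype.card V ≤ l) :
    L ^ l = 0 := by
  ext u v
  rw [← List.prod_replicate, ← List.ofFn_const, prod_ofFn_apply_eq_sum]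
  refine Finset.sum_eq_zero fun p _ => ?_
  by_contra hne
  have hedge : ∀ t : Fin l, L (p t.castSucc) (p t.succ) ≠ 0 := fun t ht =>
    hne (Finset.prod_eq_zero (Finset.mem_univ t) ht)
  have hlt : ∀ a b : Fin (l + 1), a < b → Relation.TransGen (fun a b => L a b ≠ 0) (p a) (p b) := by
    intro a b
    induction b using Fin.induction with
    | zero => exact fun hab => absurd hab (Fin.not_lt_zero a)
    | succ b ih =>
      intro hab
      rcases (Fin.le_castSucc_iff.2 hab).eq_or_lt with rfl | hab'
      · exact .single (hedge b)
      · exact (ih hab').tail (hedge b)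
  -- Pigeonhole: a walk with `l` edges has `l + 1` vertices, more than the graph, so it would
  -- contain a cycle.
  obtain ⟨a, b, hab, hp⟩ := Fintype.exists_ne_map_eq_of_card_lt p (by simp; omega)
  rcases lt_or_gt_of_ne hab with hab | hab
  · exact h (p b) (hp ▸ hlt a b hab)
  · exact h (p a) (hp ▸ hlt b a hab)

/-- All powers beyond the number of vertices vanish. This reconciles the different truncations for a
circuit and for its copy in a graph of fixed size. -/
theorem sum_pow_eq_of_acyclic [Nontrivial R] {L : Matrix V V R}
    (h : ∀ v, ¬ Relation.TransGen (fun a b => L a b ≠ 0) v v) {N N' : ℕ}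
    (hN : Fintype.card V ≤ N) (hN' : Fintype.card V ≤ N') (u v : V) :
    ∑ l ∈ Finset.range N, (L ^ l) u v = ∑ l ∈ Finset.range N', (L ^ l) u v := by
  have : ∀ N, Fintype.card V ≤ N → ∑ l ∈ Finset.range N, (L ^ l) u v =
      ∑ l ∈ Finset.range (Fintype.card V), (L ^ l) u v := by
    intro N hN
    symm
    refine Finset.sum_subset (Finset.range_mono hN) fun l _ hl => ?_
    rw [pow_eq_zero_of_acyclic h (by simpa using hl), Matrix.zero_apply]
  rw [this N hN, this N' hN']

/-- Powers of the extension of a matrix by zero. -/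
theorem pow_apply_of_injective {W : Type*} [Fintype W] [DecidableEq W] {g : V → W}
    (hg : Function.Injective g) {K : Matrix V V R} {L : Matrix W W R}
    (hL : ∀ u v, L (g u) (g v) = K u v) (h0 : ∀ w ∉ Set.range g, ∀ w', L w w' = 0) (l : ℕ)
    (u v : V) : (L ^ l) (g u) (g v) = (K ^ l) u v := by
  induction l generalizing v with
  | zero => simp [Matrix.one_apply, hg.eq_iff]
  | succ l ih =>
    rw [pow_succ, pow_succ, Matrix.mul_apply, Matrix.mul_apply]
    refine (Fintype.sum_of_injective g hg _ _ (fun w hw => ?_) fun w => ?_).symm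
    · rw [h0 w hw, mul_zero]
    · rw [ih, hL]

end Acyclic

/-! ### Small circuits as values of polynomial maps -/

namespace LinearCircuit

variable {n m : ℕ}

attribute [instance] fintypeV

theorem toMatrix_apply (C : LinearCircuit n m) [DecidableEq C.V] (i : Fin n)
    (j : Fin m) : C.toMatrix i j = ∑ l ∈ Finset.range (Fintype.card C.V),
      (Matrix.of C.label ^ l) (C.input i) (C.output j) := by
  rw [toMatrix]
  refine Finset.sum_congr rfl fun l _ => ?_
  rw [← List.prod_replicate, ← List.ofFn_const, prod_ofFn_apply_eq_sum]
  simp only [Matrix.of_apply]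
  congr!

/-- The matrices of polynomials which are computed by the graphs with `N` vertices and `s` edges
labelled by variables. -/
noncomputable def genericEntries {N s : ℕ} (e : Fin s → Fin N × Fin N) (a b : Fin n → Fin N)
    (p : Fin n × Fin n) : MvPolynomial (Fin s) ℂ :=
  ∑ l ∈ Finset.range N, ((∑ r, Matrix.single (e r).1 (e r).2 (X r)) ^ l :
    Matrix (Fin N) (Fin N) (MvPolynomial (Fin s) ℂ)) (a p.1) (b p.2)

theorem eval_genericEntries {N s : ℕ} (e : Fin s → Fin N × Fin N) (a b : Fin n → Fin N)
    (p : Fin n × Fin n) (x : Fin s → ℂ) :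
    eval x (genericEntries e a b p) = ∑ l ∈ Finset.range N,
      ((∑ r, Matrix.single (e r).1 (e r).2 (x r)) ^ l : Matrix (Fin N) (Fin N) ℂ)
        (a p.1) (b p.2) := by
  rw [genericEntries, map_sum]
  refine Finset.sum_congr rfl fun l _ => ?_
  have h1 : (eval x).mapMatrix (∑ r, Matrix.single (e r).1 (e r).2 (X r) :
      Matrix (Fin N) (Fin N) (MvPolynomial (Fin s) ℂ)) =
        ∑ r, Matrix.single (e r).1 (e r).2 (x r) := by
    rw [map_sum]
    refine Finset.sum_congr rfl fun r _ => ?_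
    ext i j
    simp [Matrix.single, apply_ite (eval x)]
  rw [← h1, ← map_pow]
  rfl

/-- A matrix with a linear circuit of size at most `s` is a value of one of finitely many
polynomial maps in `s` variables. -/
theorem exists_mem_polynomialImage {s : ℕ} (hn : 1 ≤ n) (C : LinearCircuit n n) (hC : C.size ≤ s) :
    ∃ (e : Fin s → Fin (2 * s + 2 * n) × Fin (2 * s + 2 * n))
      (a b : Fin n → Fin (2 * s + 2 * n)),
      C.toMatrix ∈ polynomialImage (genericEntries e a b) := by
  classical
  -- Room for both ends of every edge, the inputs and the outputs; all other vertices are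
  -- irrelevant.
  set N := 2 * s + 2 * n
  set E : Finset (C.V × C.V) := {e | C.label e.1 e.2 ≠ 0}
  have hE : E.card ≤ s := by
    rw [size, Set.ncard_eq_toFinset_card'] at hC
    simpa [E] using hC
  set T : Finset C.V := E.image Prod.fst ∪ E.image Prod.snd ∪
    (Finset.univ.image C.input ∪ Finset.univ.image C.output)
  have hT : T.card ≤ N := by
    have h1 := Finset.card_image_le (s := E) (f := Prod.fst)
    have h2 := Finset.card_image_le (s := E) (f := Prod.snd)
    have h3 := Finset.card_image_le (s := Finset.univ) (f := C.input)
    have h4 := Finset.card_image_le (s := Finset.univ) (f := C.output)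
    rw [Finset.card_fin] at h3 h4
    have := Finset.card_union_le (E.image Prod.fst ∪ E.image Prod.snd)
      (Finset.univ.image C.input ∪ Finset.univ.image C.output)
    have := Finset.card_union_le (E.image Prod.fst) (E.image Prod.snd)
    have := Finset.card_union_le (Finset.univ.image C.input) (Finset.univ.image C.output)
    have h5 : T.card ≤ _ := ‹(E.image Prod.fst ∪ E.image Prod.snd ∪ _).card ≤ _›
    omega
  have hfst : ∀ {u v}, C.label u v ≠ 0 → u ∈ T := fun {u v} h =>
    Finset.mem_union_left _ (Finset.mem_union_left _
      (Finset.mem_image.2 ⟨(u, v), by simpa [E] using h, rfl⟩))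
  have hsnd : ∀ {u v}, C.label u v ≠ 0 → v ∈ T := fun {u v} h =>
    Finset.mem_union_left _ (Finset.mem_union_right _
      (Finset.mem_image.2 ⟨(u, v), by simpa [E] using h, rfl⟩))
  have hin : ∀ i, C.input i ∈ T := fun i => Finset.mem_union_right _
    (Finset.mem_union_left _ (Finset.mem_image_of_mem _ (Finset.mem_univ i)))
  have hout : ∀ i, C.output i ∈ T := fun i => Finset.mem_union_right _
    (Finset.mem_union_right _ (Finset.mem_image_of_mem _ (Finset.mem_univ i)))
  obtain ⟨g⟩ : Nonempty (T ↪ Fin N) := Function.Embedding.nonempty_of_card_le (by simpa using hT)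
  obtain ⟨f⟩ : Nonempty (E ↪ Fin s) := Function.Embedding.nonempty_of_card_le (by simpa using hE)
  set K : Matrix T T ℂ := .of fun u v => C.label u v
  have hK : ∀ v, ¬ Relation.TransGen (fun a b => K a b ≠ 0) v v := fun v hv =>
    C.acyclic v (hv.lift Subtype.val fun _ _ h => h)
  have hNpos : 0 < N := by omega
  have hEmem : ∀ q : E, C.label q.1.1 q.1.2 ≠ 0 := fun q => (Finset.mem_filter.1 q.2).2
  set ends : E → Fin N × Fin N := fun q =>
    (g ⟨q.1.1, hfst (hEmem q)⟩, g ⟨q.1.2, hsnd (hEmem q)⟩)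
  -- Unused edge slots become loops at `0`, harmless because their label in `x` is `0`.
  set e : Fin s → Fin N × Fin N := Function.extend f ends fun _ => (⟨0, hNpos⟩, ⟨0, hNpos⟩)
  set x : Fin s → ℂ := Function.extend f (fun q => C.label q.1.1 q.1.2) 0
  set L : Matrix (Fin N) (Fin N) ℂ := ∑ r, Matrix.single (e r).1 (e r).2 (x r) with hL
  have hLsum : L = ∑ q : E, Matrix.single (ends q).1 (ends q).2 (C.label q.1.1 q.1.2) := by
    refine (Fintype.sum_of_injective f f.injective _ _ (fun r hr => ?_) fun q => ?_).symm
    · simp only [x, Function.extend_apply' _ _ _ hr, Pi.zero_apply, Matrix.single_zero]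
    · simp only [e, x, f.injective.extend_apply]
  refine ⟨e, fun i => g ⟨_, hin i⟩, fun j => g ⟨_, hout j⟩, x, fun p => ?_⟩
  rw [eval_genericEntries, entries, toMatrix_apply]
  have hLg : ∀ u v, L (g u) (g v) = K u v := by
    intro u v
    rw [hLsum, Matrix.sum_apply]
    simp only [ends, Matrix.single_apply, g.injective.eq_iff, Subtype.ext_iff]
    by_cases h : C.label u v = 0
    · rw [Finset.sum_eq_zero]
      · exact h.symm
      · rintro ⟨⟨a, b⟩, hq⟩ -
        refine if_neg ?_
        rintro ⟨h1, h2⟩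
        dsimp only at h1 h2
        subst h1 h2
        simp [E, h] at hq
    · rw [Finset.sum_eq_single ⟨(u.1, v.1), by simpa [E] using h⟩]
      · simp [K]
      · rintro ⟨⟨a, b⟩, hq⟩ - hne
        refine if_neg ?_
        rintro ⟨h1, h2⟩
        exact hne (Subtype.ext (Prod.ext h1 h2))
      · simp
  have hL0 : ∀ w ∉ Set.range g, ∀ w', L w w' = 0 := by
    intro w hw w'
    rw [hLsum, Matrix.sum_apply]
    refine Finset.sum_eq_zero fun q _ => ?_
    rw [Matrix.single_apply, if_neg]
    rintro ⟨rfl, -⟩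
    exact hw ⟨_, rfl⟩
  have hC0 : ∀ w ∉ Set.range (Subtype.val : T → C.V), ∀ w', (Matrix.of C.label) w w' = 0 := by
    intro w hw w'
    by_contra hne
    exact hw ⟨⟨w, hfst hne⟩, rfl⟩
  have h1 : ∀ l, (Matrix.of C.label ^ l) (C.input p.1) (C.output p.2) =
      (K ^ l) ⟨_, hin p.1⟩ ⟨_, hout p.2⟩ := fun l =>
    pow_apply_of_injective Subtype.val_injective (fun _ _ => rfl) hC0 l ⟨_, hin p.1⟩ ⟨_, hout p.2⟩
  rw [← hL]
  simp only [h1, pow_apply_of_injective g.injective hLg hL0]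
  refine sum_pow_eq_of_acyclic hK ?_ (by simpa using hT) _ _
  exact Fintype.card_le_of_injective _ Subtype.val_injective

end LinearCircuit

end Butterfly

namespace Butterfly

open MvPolynomial

namespace LinearCircuit

/-! ### The layered circuit of a product -/

section Layered

variable {n k : ℕ} (M : Fin k → Matrix (Fin n) (Fin n) ℂ) (r : ℕ)

/-- The vertices of the layered graph with `k + 1` levels of `n` vertices and `r` isolated edges. -/
abbrev LayeredVertex (n k r : ℕ) : Type := (Fin (k + 1) × Fin n) ⊕ (Fin r × Bool)

/-- The labels of the layered graph of a product of matrices, together with `r` isolated edges. -/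
def layeredLabel : LayeredVertex n k r → LayeredVertex n k r → ℂ
  | .inl (s, i), .inl (t, j) =>
      if h : (s : ℕ) < k ∧ (t : ℕ) = s + 1 then M ⟨s, h.1⟩ i j else 0
  | .inr (a, false), .inr (b, true) => if a = b then 1 else 0
  | _, _ => 0

/-- The level of a vertex of the layered graph. -/
def level : LayeredVertex n k r → ℕ
  | .inl (s, _) => s
  | .inr (_, b) => b.toNat

variable {M r}

/-- Strict growth of the level excludes cycles and edges into the inputs, which have level `0`. -/
theorem level_lt_level {u v : LayeredVertex n k r}
    (h : layeredLabel M r u v ≠ 0) : level r u < level r v := by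
  match u, v, h with
  | .inl (s, i), .inl (t, j), h =>
    have : (s : ℕ) < k ∧ (t : ℕ) = s + 1 := by
      by_contra hc
      exact h (dif_neg hc)
    simp only [level]
    omega
  | .inr (a, false), .inr (b, true), h => simp [level]
  | .inr (a, true), .inr (b, _), h => simp [layeredLabel] at h
  | .inr (a, false), .inr (b, false), h => simp [layeredLabel] at h
  | .inl _, .inr _, h => simp [layeredLabel] at h
  | .inr (a, _), .inl _, h => simp [layeredLabel] at h

variable (M r)

/-- The layered circuit of a product of matrices, with `r` additional isolated edges. -/
def layered : LinearCircuit n n where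
  V := LayeredVertex n k r
  label := layeredLabel M r
  acyclic v hv := by
    have : ∀ {u v}, Relation.TransGen (fun a b => layeredLabel M r a b ≠ 0) u v →
        level r u < level r v := by
      intro u v h
      induction h with
      | single h => exact level_lt_level h
      | tail _ h ih => exact ih.trans (level_lt_level h)
    exact (this hv).false
  input := ⟨fun i => .inl (0, i), fun i j h => by simpa using h⟩
  output := ⟨fun i => .inl (Fin.last k, i), fun i j h => by simpa using h⟩
  input_source i u := by
    by_contra h
    exact Nat.not_lt_zero _ (level_lt_level h)

/-- Walks of length `l` from an input reach exactly level `l`, and never the isolated edges; the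
second claim keeps the induction going. -/
theorem layeredLabel_pow (l : ℕ) (i : Fin n) :
    (∀ t j, (Matrix.of (layeredLabel M r) ^ l) (.inl (0, i)) (.inl (t, j)) =
      if (t : ℕ) = l then ((List.ofFn M).take l).prod i j else 0) ∧
    ∀ b, (Matrix.of (layeredLabel M r) ^ l) (.inl (0, i)) (.inr b) = 0 := by
  induction l with
  | zero =>
    refine ⟨fun t j => ?_, fun b => by simp⟩
    by_cases h : t = 0
    · simp [Matrix.one_apply, h]
    · have h' : (t : ℕ) ≠ 0 := fun h0 => h (Fin.ext h0)
      simp [Ne.symm h, h']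
  | succ l ih =>
    have hsum : ∀ v, (Matrix.of (layeredLabel M r) ^ (l + 1)) (.inl (0, i)) v =
        ∑ s : Fin (k + 1), ∑ m, (if (s : ℕ) = l then ((List.ofFn M).take l).prod i m else 0) *
          layeredLabel M r (.inl (s, m)) v := by
      intro v
      rw [pow_succ, Matrix.mul_apply, Fintype.sum_sum_type, Fintype.sum_prod_type]
      simp only [ih.1, ih.2, zero_mul, Finset.sum_const_zero, add_zero]
      rfl
    refine ⟨fun t j => ?_, fun b => ?_⟩
    · rw [hsum]
      split_ifs with ht
      · have hl : l < k := by omega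
        rw [Finset.sum_eq_single ⟨l, by omega⟩]
        · have h1 : (List.ofFn M).take (l + 1) = (List.ofFn M).take l ++ [M ⟨l, hl⟩] := by
            rw [List.take_succ_eq_append_getElem (by simpa using hl)]
            simp
          rw [h1, List.prod_append, List.prod_singleton, Matrix.mul_apply]
          simp [layeredLabel, hl, ht]
        · intro s _ hs
          have : (s : ℕ) ≠ l := fun h => hs (Fin.ext h)
          simp [this]
        · simp
      · refine Finset.sum_eq_zero fun s _ => Finset.sum_eq_zero fun m _ => ?_
        by_cases hs : (s : ℕ) = l
        · have : ¬ ((s : ℕ) < k ∧ (t : ℕ) = s + 1) := by omega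
          simp [layeredLabel, this]
        · simp [hs]
    · rw [hsum]
      simp [layeredLabel]

theorem toMatrix_layered : (layered M r).toMatrix = (List.ofFn M).prod := by
  ext i j
  let : DecidableEq (layered M r).V :=
    inferInstanceAs (DecidableEq (LayeredVertex n k r))
  rw [toMatrix_apply]
  -- All paths have length `k`, which must lie within the range of summation.
  have hcard : k < Fintype.card (layered M r).V := by
    have h1 : Fintype.card (layered M r).V =
        Fintype.card (LayeredVertex n k r) := Fintype.card_congr (Equiv.refl _)
    have hn : 0 < n := i.pos
    rw [h1]
    simp
    nlinarith
  have hpow : ∀ l, (Matrix.of (layered M r).label ^ l) ((layered M r).input i)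
      ((layered M r).output j) = if k = l then ((List.ofFn M).take l).prod i j else 0 := by
    intro l
    have h := (layeredLabel_pow M r l i).1 (Fin.last k) j
    rw [Fin.val_last] at h
    exact h
  simp only [hpow]
  rw [Finset.sum_ite_eq, if_pos (Finset.mem_range.2 hcard), List.take_of_length_le (by simp)]

theorem size_layered : (layered M r).size =
    Nat.card {e : Fin k × Fin n × Fin n // M e.1 e.2.1 e.2.2 ≠ 0} + r := by
  let Φ : {e : Fin k × Fin n × Fin n // M e.1 e.2.1 e.2.2 ≠ 0} ⊕ Fin r →
      LayeredVertex n k r × LayeredVertex n k r :=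
    Sum.elim (fun e => (.inl (e.1.1.castSucc, e.1.2.1), .inl (e.1.1.succ, e.1.2.2)))
      fun a => (.inr (a, false), .inr (a, true))
  have hΦ : Function.Injective Φ := by
    rintro (⟨⟨t, i, j⟩, h⟩ | a) (⟨⟨t', i', j'⟩, h'⟩ | a') heq
    · simp only [Φ, Sum.elim_inl, Prod.mk.injEq, Sum.inl.injEq] at heq
      obtain ⟨⟨h1, h2⟩, -, h3⟩ := heq
      have h1 := Fin.castSucc_injective _ h1
      subst h1 h2 h3
      rfl
    · simp [Φ] at heq
    · simp [Φ] at heq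
    · simp only [Φ, Sum.elim_inr, Prod.mk.injEq, Sum.inr.injEq] at heq
      rw [heq.1.1]
  have hrange : {e : LayeredVertex n k r × LayeredVertex n k r | layeredLabel M r e.1 e.2 ≠ 0} =
      Set.range Φ := by
    ext ⟨u, v⟩
    constructor
    · intro h
      change layeredLabel M r u v ≠ 0 at h
      match u, v, h with
      | .inl (s, i), .inl (t, j), h =>
        have hst : (s : ℕ) < k ∧ (t : ℕ) = s + 1 := by
          by_contra hc
          exact h (dif_neg hc)
        refine ⟨.inl ⟨(⟨s, hst.1⟩, i, j), ?_⟩, ?_⟩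
        · simpa [layeredLabel, hst] using h
        · have h2 : t = (⟨s, hst.1⟩ : Fin k).succ := Fin.ext hst.2
          exact Prod.ext rfl (congrArg (fun t => (.inl (t, j) : LayeredVertex n k r)) h2.symm)
      | .inr (a, false), .inr (b, true), h =>
        have : a = b := by simpa [layeredLabel] using h
        exact ⟨.inr a, by rw [this]; rfl⟩
      | .inr (a, true), .inr (b, _), h => simp [layeredLabel] at h
      | .inr (a, false), .inr (b, false), h => simp [layeredLabel] at h
      | .inl _, .inr _, h => simp [layeredLabel] at h
      | .inr (a, _), .inl _, h => simp [layeredLabel] at h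
    · rintro ⟨⟨⟨t, i, j⟩, h⟩ | a, heq⟩
      · obtain ⟨rfl, rfl⟩ := Prod.ext_iff.1 heq
        change layeredLabel M r (.inl (t.castSucc, i)) (.inl (t.succ, j)) ≠ 0
        simpa [layeredLabel] using h
      · obtain ⟨rfl, rfl⟩ := Prod.ext_iff.1 heq
        change layeredLabel M r (.inr (a, false)) (.inr (a, true)) ≠ 0
        simp [layeredLabel]
  change Set.ncard {e : LayeredVertex n k r × LayeredVertex n k r |
    layeredLabel M r e.1 e.2 ≠ 0} = _
  rw [hrange, ← Nat.card_coe_set_eq, Nat.card_range_of_injective hΦ, Nat.card_sum,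
    Nat.card_fin]

end Layered

/-- A product of `k` matrices which are supported on `2n` entries has a linear circuit with
exactly `2nk` edges. -/
theorem exists_size_eq {n k : ℕ} {S : Fin k → Finset (Fin n × Fin n)} (hS : IsConfiguration S)
    {A : Matrix (Fin n) (Fin n) ℂ} (hA : A ∈ productSet S) :
    ∃ C : LinearCircuit n n, C.toMatrix = A ∧ C.size = 2 * n * k := by
  obtain ⟨M, hM, rfl⟩ := hA
  have hle : Nat.card {e : Fin k × Fin n × Fin n // M e.1 e.2.1 e.2.2 ≠ 0} ≤ 2 * n * k := by
    have h1 : Nat.card (Σ t : Fin k, S t) = 2 * n * k := by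
      rw [Nat.card_eq_fintype_card, Fintype.card_sigma]
      simp [hS _, mul_comm]
    rw [← h1]
    refine Nat.card_le_card_of_injective (fun e => ⟨e.1.1, e.1.2, ?_⟩) ?_
    · by_contra hc
      exact e.2 (hM _ _ _ hc)
    · rintro ⟨⟨t, p⟩, h⟩ ⟨⟨t', p'⟩, h'⟩ heq
      simp only [Sigma.mk.injEq] at heq
      obtain ⟨rfl, heq⟩ := heq
      have := congrArg Subtype.val (eq_of_heq heq)
      dsimp only at this
      subst this
      rfl
  -- Zero entries of the factors give no edges; isolated edges make up the deficit without affecting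
  -- the matrix.
  refine ⟨layered M (2 * n * k - Nat.card {e : Fin k × Fin n × Fin n // M e.1 e.2.1 e.2.2 ≠ 0}),
    toMatrix_layered _ _, ?_⟩
  rw [size_layered]
  omega

end LinearCircuit

/-! ### Irreducible components and their general elements -/

section Components

variable {k : ℕ}

theorem isIrreducibleVariety_zariskiClosure_productSet {n : ℕ}
    (S : Fin k → Finset (Fin n × Fin n)) :
    IsIrreducibleVariety (zariskiClosure (productSet S)) := by
  refine ⟨isZariskiClosed_zariskiClosure _, ?_⟩
  rw [idealOf_zariskiClosure, productSet_eq_polynomialImage]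
  exact isPrime_idealOf_polynomialImage _

theorem zariskiClosure_productSet_subset {S : Fin k → Finset (Fin (2 ^ k) × Fin (2 ^ k))}
    (hS : IsConfiguration S) : zariskiClosure (productSet S) ⊆ butterflyVariety k :=
  zariskiClosure_mono fun _ hA => ⟨S, hS, hA⟩

theorem exists_configuration_of_subset {Y : Set (Matrix (Fin (2 ^ k)) (Fin (2 ^ k)) ℂ)}
    (hY : IsIrreducibleVariety Y) (h : Y ⊆ butterflyVariety k) :
    ∃ S : Fin k → Finset (Fin (2 ^ k) × Fin (2 ^ k)),
      IsConfiguration S ∧ Y ⊆ zariskiClosure (productSet S) := by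
  have hU : butterflyMatrices k =
      ⋃ S : {S : Fin k → Finset (Fin (2 ^ k) × Fin (2 ^ k)) // IsConfiguration S},
        productSet S.1 := by
    ext A
    simp [butterflyMatrices]
  rw [butterflyVariety, hU] at h
  obtain ⟨S, hS⟩ := exists_subset_zariskiClosure_of_iUnion hY.2 _ h
  exact ⟨S.1, S.2, hS⟩

theorem exists_eq_zariskiClosure_of_isComponent {Z : Set (Matrix (Fin (2 ^ k)) (Fin (2 ^ k)) ℂ)}
    (hZ : IsComponent Z (butterflyVariety k)) :
    ∃ S : Fin k → Finset (Fin (2 ^ k) × Fin (2 ^ k)),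
      IsConfiguration S ∧ Z = zariskiClosure (productSet S) := by
  obtain ⟨S, hS, hZS⟩ := exists_configuration_of_subset hZ.1.1 hZ.1.2
  exact ⟨S, hS, hZ.eq_of_subset
    ⟨isIrreducibleVariety_zariskiClosure_productSet S, zariskiClosure_productSet_subset hS⟩ hZS⟩

/-- A larger irreducible subvariety lies in the closure for some `S'`. That closure inherits an
invertible matrix, so its dimension is at most `n(k+1)`, which the smaller variety already attains;
all of them coincide. -/
theorem isComponent_of_isEfficient (hk : 1 ≤ k) {S : Fin k → Finset (Fin (2 ^ k) × Fin (2 ^ k))}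
    (hS : IsEfficient S) :
    IsComponent (zariskiClosure (productSet S)) (butterflyVariety k) := by
  refine ⟨⟨isIrreducibleVariety_zariskiClosure_productSet S,
    zariskiClosure_productSet_subset hS.1⟩, fun Y hY hSY => ?_⟩
  obtain ⟨S', hS', hYS'⟩ := exists_configuration_of_subset hY.1 hY.2
  obtain ⟨A, hA, hdet⟩ := hS.2.2
  have hdim := dim_productSet_le hk hS' (exists_det_ne_zero_of_zariskiClosure
    ⟨A, hYS' (hSY (subset_zariskiClosure _ hA)), hdet⟩)
  have heq := eq_of_subset_of_dim_le (isZariskiClosed_zariskiClosure _)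
    (isIrreducibleVariety_zariskiClosure_productSet S') (hSY.trans hYS')
    ((dim_zariskiClosure _).trans (dim_productSet_eq hk hS))
    ((dim_zariskiClosure _).trans_le hdim)
  change Y ⊆ _
  rw [heq]
  exact hYS'

theorem dim_le_of_isComponent (hk : 1 ≤ k) {Z : Set (Matrix (Fin (2 ^ k)) (Fin (2 ^ k)) ℂ)}
    (hZ : IsComponent Z (butterflyVariety k)) (h : ∃ A ∈ Z, A.det ≠ 0) :
    dim Z ≤ ((2 ^ k * (k + 1) : ℕ) : WithBot ℕ∞) := by
  obtain ⟨S, hS, rfl⟩ := exists_eq_zariskiClosure_of_isComponent hZ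
  rw [dim_zariskiClosure]
  exact dim_productSet_le hk hS (exists_det_ne_zero_of_zariskiClosure h)

/-- The elements of an irreducible variety of dimension greater than `s` with linear circuits of
size at most `s` lie in a proper subvariety. -/
theorem exists_notMem_idealOf_forall_circuit {n : ℕ} (hn : 1 ≤ n) {s : ℕ}
    {Z : Set (Matrix (Fin n) (Fin n) ℂ)} (hZ : (idealOf Z).IsPrime)
    (hdim : ((s + 1 : ℕ) : WithBot ℕ∞) ≤ dim Z) :
    ∃ g, g ∉ idealOf Z ∧ ∀ C : LinearCircuit n n, C.size ≤ s →
      eval (entries C.toMatrix) g = 0 := by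
  let τ := (Fin s → Fin (2 * s + 2 * n) × Fin (2 * s + 2 * n)) ×
    (Fin n → Fin (2 * s + 2 * n)) × (Fin n → Fin (2 * s + 2 * n))
  let F : τ → Fin n × Fin n → MvPolynomial (Fin s) ℂ := fun d =>
    LinearCircuit.genericEntries d.1 d.2.1 d.2.2
  have hF : ∀ d, ∃ g ∈ idealOf (polynomialImage (F d)), g ∉ idealOf Z := by
    intro d
    by_contra! hle
    have h1 := (hdim.trans (dim_mono hle)).trans (dim_polynomialImage_le (F d))
    rw [Fintype.card_fin] at h1
    have : s + 1 ≤ s := by exact_mod_cast h1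
    omega
  choose g hgF hgZ using hF
  refine ⟨∏ d, g d, fun h => ?_, fun C hC => ?_⟩
  · obtain ⟨d, -, hd⟩ := hZ.prod_mem_iff.1 h
    exact hgZ d hd
  · obtain ⟨e, a, b, hmem⟩ := C.exists_mem_polynomialImage hn hC
    rw [map_prod]
    exact Finset.prod_eq_zero (Finset.mem_univ ((e, a, b) : τ))
      (mem_idealOf.1 (hgF (e, a, b)) _ hmem)

theorem holdsForGeneral_circuit {Z : Set (Matrix (Fin (2 ^ k)) (Fin (2 ^ k)) ℂ)}
    (hZ : IsComponent Z (butterflyVariety k))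
    (hdim : ((2 ^ k * (k + 1) : ℕ) : WithBot ℕ∞) ≤ dim Z) :
    HoldsForGeneral Z fun A =>
      (∃ C : LinearCircuit (2 ^ k) (2 ^ k), C.toMatrix = A ∧ C.size = 2 * 2 ^ k * k) ∧
      ¬ ∃ C : LinearCircuit (2 ^ k) (2 ^ k),
        C.toMatrix = A ∧ C.size ≤ 2 ^ k * (k + 1) - 1 := by
  have hprime := hZ.1.1.2
  obtain ⟨g₁, hg₁, h₁⟩ := exists_notMem_idealOf_forall_circuit (s := 2 ^ k * (k + 1) - 1)
    Nat.one_le_two_pow hprime (by rwa [Nat.sub_add_cancel (Nat.mul_pos (by positivity) (by omega))])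
  obtain ⟨S, hS, rfl⟩ := exists_eq_zariskiClosure_of_isComponent hZ
  obtain ⟨g₂, hg₂, h₂⟩ := exists_notMem_idealOf_forall_mem_polynomialImage
    (productEntries (genericFactor S))
  rw [← productSet_eq_polynomialImage] at hg₂ h₂
  -- Nonvanishing of `g₁` excludes small circuits, that of `g₂` provides an actual factorization;
  -- primality keeps the product outside the ideal.
  refine holdsForGeneral_of_forall_eval_ne_zero hprime (g := g₁ * g₂) (fun h => ?_) ?_
  · rw [idealOf_zariskiClosure] at hg₁ hprime h
    exact (hprime.mem_or_mem h).elim hg₁ hg₂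
  · intro A hA hne
    rw [map_mul] at hne
    refine ⟨LinearCircuit.exists_size_eq hS (h₂ A hA (right_ne_zero_of_mul hne)), ?_⟩
    rintro ⟨C, rfl, hC⟩
    exact left_ne_zero_of_mul hne (h₁ C hC)

end Components

end Butterfly

theorem mainTheorem12 (k : ℕ) (hk : 1 ≤ k) (n : ℕ) (hn : n = 2 ^ k) :
    -- the supports of the butterfly graph are efficient
    Butterfly.IsEfficient (Butterfly.butterflyGraph k) ∧
    -- efficient supports give irreducible components, of dimension `n (log n + 1)`
    (∀ S : Fin k → Finset (Fin (2 ^ k) × Fin (2 ^ k)), Butterfly.IsEfficient S →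
      Butterfly.IsComponent (Butterfly.zariskiClosure (Butterfly.productSet S))
        (Butterfly.butterflyVariety k) ∧
      Butterfly.dim (Butterfly.zariskiClosure (Butterfly.productSet S)) =
        ((n * (k + 1) : ℕ) : WithBot ℕ∞)) ∧
    -- this is the largest dimension of a component that contains an invertible matrix
    (∀ Z, Butterfly.IsComponent Z (Butterfly.butterflyVariety k) → (∃ A ∈ Z, A.det ≠ 0) →
      Butterfly.dim Z ≤ ((n * (k + 1) : ℕ) : WithBot ℕ∞)) ∧
    -- the size of linear circuits for general elements of the components of at least this dimension
    (∀ Z, Butterfly.IsComponent Z (Butterfly.butterflyVariety k) →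
      ((n * (k + 1) : ℕ) : WithBot ℕ∞) ≤ Butterfly.dim Z →
      Butterfly.HoldsForGeneral Z fun A =>
        (∃ C : Butterfly.LinearCircuit (2 ^ k) (2 ^ k),
          C.toMatrix = A ∧ C.size = 2 * n * k) ∧
        ¬ ∃ C : Butterfly.LinearCircuit (2 ^ k) (2 ^ k),
          C.toMatrix = A ∧ C.size ≤ n * (k + 1) - 1) ∧
    -- every factorizable matrix has a linear circuit of size at most `2 n log n`
    (∀ A ∈ Butterfly.butterflyMatrices k, ∃ C : Butterfly.LinearCircuit (2 ^ k) (2 ^ k),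
      C.toMatrix = A ∧ C.size ≤ 2 * n * k) := by
  subst hn
  refine ⟨Butterfly.isEfficient_butterflyGraph k, fun S hS =>
    ⟨Butterfly.isComponent_of_isEfficient hk hS,
      (Butterfly.dim_zariskiClosure _).trans (Butterfly.dim_productSet_eq hk hS)⟩,
    fun Z hZ h => Butterfly.dim_le_of_isComponent hk hZ h,
    fun Z hZ h => Butterfly.holdsForGeneral_circuit hZ h, ?_⟩
  rintro A ⟨S, hS, hA⟩
  obtain ⟨C, hC, hsize⟩ := Butterfly.LinearCircuit.exists_size_eq hS hA
  exact ⟨C, hC, hsize.le⟩
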